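/- A quantum circuit with fan-out is a sequence of layers. Each layer is a set of gates acting on pairwise disjoint sets of qubits, and each gate is either an arbitrary one-qubit unitary or an unbounded fan-out gate $|y_1\rangle\cdots|y_k\rangle|x\rangle\mapsto|y_1\oplus x\rangle\cdots|y_k\oplus x\rangle|x\rangle$ (for $k=1$ this is the controlled-not gate). The depth of a circuit is its number of layers. The size of a gate is the number of qubits it affects, and the size of a circuit is the total size of its gates. For $x\in\{0,1\}^n$ let $|x|$ denote the Hamming weight. An Or-reduction $n\to m$ with error $\varepsilon$ is a circuit, possibly using ancilla qubits that start in $|0\rangle$ and are returned to $|0\rangle$, which for every $x\in\{0,1\}^n$ maps $|x\rangle|0^m\rangle$ to $|x\rangle|\varphi\rangle$ for some state $|\varphi\rangle$ (depending on $x$) such that $|\varphi\rangle=|0^m\rangle$ if $|x|=0$, and $|\langle 0^m|\varphi\rangle|\le\varepsilon$ if $|x|\neq 0$. Let $\log^{(d)}n$ denote the $d$-times iterated binary logarithm of $n$, with the convention that it is replaced by $1$ whenever it is undefined or less than $1$. **Theorem.** There exist constants $c_1,c_2$ such that for every integer $d\ge 1$ and every integer $n\ge 1$ there is an Or-reduction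 $n\to 1$ with error $\frac1n$, depth at most $c_1 d$, and size at most $c_2\, d\, n\log^{(d)} n$. -/

import Mathlib

/-! ## States and gates -/

namespace FanOutCircuit

/-- State vectors of the qubits in `Q`: amplitudes over the computational basis `Q → Bool`. -/
abbrev State (Q : Type*) : Type _ := (Q → Bool) → ℂ

/-- The all-zero string. -/
def zeros (Q : Type*) : Q → Bool := fun _ => false

/-- The computational basis state `|x⟩`. -/
noncomputable def ket {Q : Type*} (x : Q → Bool) : State Q :=
  open Classical in fun y => if y = x then 1 else 0

/-- A gate: an arbitrary one-qubit unitary applied to the qubit `q`, or an unbounded fan-out gate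
with one control qubit and an arbitrary set of targets (not containing the control). A
controlled-not gate is a fan-out gate with one target. -/
inductive Gate (Q : Type*) where
  | oneQubit (q : Q) (U : Matrix.unitaryGroup Bool ℂ) : Gate Q
  | fanOut (control : Q) (targets : Finset Q) (h : control ∉ targets) : Gate Q

variable {Q : Type*} [DecidableEq Q]

/-- The set of qubits affected by a gate. -/
def Gate.qubits : Gate Q → Finset Q
  | .oneQubit q _ => {q}
  | .fanOut c T _ => insert c T

/-- The size of a gate is the number of affected qubits. -/
def Gate.size (g : Gate Q) : ℕ := g.qubits.card

/-- The classical action of fan-out on bit strings: xor the control bit into every target bit. -/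
def fanOutBits (c : Q) (T : Finset Q) (x : Q → Bool) : Q → Bool :=
  fun q => if q ∈ T then Bool.xor (x q) (x c) else x q

/-- The action of a gate on states. The map `fanOutBits c T` is an involution when `c ∉ T`, so
composing with it sends `|x⟩` to `|fanOutBits c T x⟩`. -/
noncomputable def Gate.apply : Gate Q → State Q → State Q
  | .oneQubit q U, ψ => fun x =>
      ∑ b : Bool, (U : Matrix Bool Bool ℂ) (x q) b * ψ (Function.update x q b)
  | .fanOut c T _, ψ => fun x => ψ (fanOutBits c T x)

/-- The fan-out gate sends the basis state `|x⟩` to the basis state `|fanOutBits c T x⟩`. -/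
theorem Gate.apply_fanOut_ket (c : Q) (T : Finset Q) (h : c ∉ T) (x : Q → Bool) :
    (Gate.fanOut c T h).apply (ket x) = ket (fanOutBits c T x) := by
  have inv : ∀ y : Q → Bool, fanOutBits c T (fanOutBits c T y) = y := by
    intro y
    funext q
    by_cases hq : q ∈ T <;> simp [fanOutBits, hq, h]
  funext y
  have hiff : fanOutBits c T y = x ↔ y = fanOutBits c T x := by
    constructor
    · intro hy
      rw [← hy, inv]
    · intro hy
      rw [hy, inv]
  by_cases hy : y = fanOutBits c T x
  · simp [Gate.apply, ket, hy, inv]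
  · have hy' : fanOutBits c T y ≠ x := fun e => hy (hiff.mp e)
    simp [Gate.apply, ket, hy, hy']

/-! ## Circuits -/

/-- A layer: gates acting on pairwise disjoint sets of qubits. -/
structure Layer (Q : Type*) [DecidableEq Q] where
  gates : List (Gate Q)
  disjoint : gates.Pairwise fun g h => Disjoint g.qubits h.qubits

/-- Apply all gates of a layer (their order does not matter, since they act on disjoint qubits). -/
noncomputable def Layer.apply (L : Layer Q) (ψ : State Q) : State Q :=
  L.gates.foldl (fun φ g => g.apply φ) ψ

/-- The total size of the gates of a layer. -/
def Layer.size (L : Layer Q) : ℕ := (L.gates.map Gate.size).sum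

/-- A quantum circuit with fan-out: a sequence of layers. -/
abbrev Circuit (Q : Type*) [DecidableEq Q] : Type _ := List (Layer Q)

/-- Apply the layers of a circuit one after the other. -/
noncomputable def Circuit.apply (C : Circuit Q) (ψ : State Q) : State Q :=
  C.foldl (fun φ L => L.apply φ) ψ

/-- The depth of a circuit is the number of its layers. -/
def Circuit.depth (C : Circuit Q) : ℕ := C.length

/-- The size of a circuit is the total size of all its gates. -/
def Circuit.size (C : Circuit Q) : ℕ := (C.map Layer.size).sum

/-! ## Or-reductions -/

/-- The product state `|ψ₁⟩ |ψ₂⟩ |ψ₃⟩` on three registers. -/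
def tensor₃ {A B D : Type*} (ψ₁ : State A) (ψ₂ : State B) (ψ₃ : State D) : State (A ⊕ B ⊕ D) :=
  fun z => ψ₁ (fun i => z (.inl i)) * ψ₂ (fun j => z (.inr (.inl j))) *
    ψ₃ (fun k => z (.inr (.inr k)))

/-- The Hamming weight `|x|`. -/
def hammingWeight {n : ℕ} (x : Fin n → Bool) : ℕ :=
  (Finset.univ.filter fun i => x i = true).card

/-- `C` is an Or-reduction `n → m` with error `ε`, using `a` ancilla qubits that start in `|0⟩`
and are cleaned at the end: for every `x ∈ {0,1}ⁿ`, `C` maps `|x⟩ |0ᵐ⟩ |0ᵃ⟩` to `|x⟩ |φ⟩ |0ᵃ⟩`,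
where `|φ⟩ = |0ᵐ⟩` if `|x| = 0`, and `|⟨0ᵐ|φ⟩| ≤ ε` if `|x| ≠ 0`. -/
def IsOrReduction {n m a : ℕ} (ε : ℝ) (C : Circuit (Fin n ⊕ Fin m ⊕ Fin a)) : Prop :=
  ∀ x : Fin n → Bool, ∃ φ : State (Fin m),
    C.apply (tensor₃ (ket x) (ket (zeros (Fin m))) (ket (zeros (Fin a)))) =
      tensor₃ (ket x) φ (ket (zeros (Fin a))) ∧
    (hammingWeight x = 0 → φ = ket (zeros (Fin m))) ∧
    (hammingWeight x ≠ 0 → ‖φ (zeros (Fin m))‖ ≤ ε)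

/-! ## The iterated logarithm -/

/-- The `d`-times iterated binary logarithm of `x`, truncated below at `1`: its value is
`max 1 (log log ⋯ log x)` when the `d`-fold iterated logarithm exists, and `1` otherwise. -/
noncomputable def ilog : ℕ → ℝ → ℝ
  | 0, x => x
  | d + 1, x => max 1 (Real.logb 2 (ilog d x))

/-- As long as the iterated logarithms are at least `1`, `ilog` is the plain iterate of `log₂`. -/
theorem ilog_eq_iterate (d : ℕ) (x : ℝ) (h : ∀ j ≤ d, 1 ≤ (Real.logb 2)^[j] x) :
    ilog d x = (Real.logb 2)^[d] x := by
  induction d with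
  | zero => rfl
  | succ d ih =>
    have h1 := h (d + 1) le_rfl
    rw [Function.iterate_succ_apply'] at h1 ⊢
    rw [ilog, ih fun j hj => h j (by omega)]
    exact max_eq_right h1

end FanOutCircuit

/-! The circuit built here computes the disjunction of the inputs exactly, so the error is 0.
Everything rests on one constant-depth building block, followed by a recursion on `d`.

Tools. Conjugating a controlled phase by Hadamards on its target gives the operator `mix`. The
controlled sign is symmetric in its two qubits, so Hadamards on all qubits reverse a fan-out and
turn it into a parity gate (`had_fan_had`). Copying qubits by fan-out and collecting the copies by
parity gates then applies many phases conditioned on parities simultaneously (`impl_diag_par`,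
`impl_mix_all`).

Building block (`impl_orBits`). Let a block have weight `w < 2 ^ m`. For each `i < m` an ancilla is
rotated by `w` times the angle `2π / 2 ^ (i + 1)` in the Hadamard basis. If `w = 0`, all ancillas
stay 0. If `w = 2 ^ a * b` with `b` odd, ancilla `a` becomes exactly 1. The disjunction of the block
is therefore the disjunction of only `m` bits, and this is a linear combination of their `2 ^ m`
parities, hence a product of phases. With `x` bits in `y` blocks the size is of order `x * m + y * 2
^ m * m`, up to lower-order terms.

Recursion (`impl_or`). Cut `n` bits into about `n / B` blocks of at most `B` bits, where `B` is
about `ilog d n`. Then `m` is of order `ilog (d + 1) n`, so the block stage has size of order `n *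
ilog (d + 1) n`. The depth-`d` construction on the block values adds only a term linear in `n` for
its iterated logarithm, because that logarithm is at most `B`. Each level adds constant depth. -/

/-! ## Relabelling the qubits of a circuit -/

namespace FanOutCircuit

open Function

variable {Q Q' : Type*} [DecidableEq Q] [DecidableEq Q']

/-- Relabel the qubits of a gate along an embedding. -/
def Gate.map (e : Q ↪ Q') : Gate Q → Gate Q'
  | .oneQubit q U => .oneQubit (e q) U
  | .fanOut c T h => .fanOut (e c) (T.map e) (by simpa using h)

theorem Gate.qubits_map (e : Q ↪ Q') (g : Gate Q) : (g.map e).qubits = g.qubits.map e := by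
  cases g <;> simp [Gate.map, Gate.qubits, Finset.map_insert]

/-- Relabel the qubits of a layer along an embedding. -/
def Layer.map (e : Q ↪ Q') (L : Layer Q) : Layer Q' where
  gates := L.gates.map (Gate.map e)
  disjoint := by
    rw [List.pairwise_map]
    refine L.disjoint.imp fun {g h} hd => ?_
    rw [Gate.qubits_map, Gate.qubits_map]
    exact (Finset.disjoint_map e).2 hd

theorem Layer.size_map (e : Q ↪ Q') (L : Layer Q) : (L.map e).size = L.size := by
  simp only [Layer.size, Layer.map, List.map_map]
  congr 2
  funext g
  simp [Gate.size, Gate.qubits_map]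

/-- Relabel the qubits of a circuit along an embedding. -/
def Circuit.map (e : Q ↪ Q') (C : Circuit Q) : Circuit Q' := List.map (Layer.map e) C

theorem Circuit.depth_map (e : Q ↪ Q') (C : Circuit Q) :
    Circuit.depth (Circuit.map e C) = Circuit.depth C := by
  simp [Circuit.depth, Circuit.map]

theorem Circuit.size_map (e : Q ↪ Q') (C : Circuit Q) :
    Circuit.size (Circuit.map e C) = Circuit.size C := by
  simp only [Circuit.size, Circuit.map, List.map_map]
  congr 2
  funext L
  simp [Layer.size_map]

/-- The restriction of a state to the strings that agree with `z` off the range of `e`. -/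
noncomputable def slice (e : Q ↪ Q') (z : Q' → Bool) (ψ : State Q') : State Q :=
  fun y => ψ (extend e y z)

omit [DecidableEq Q] [DecidableEq Q'] in
theorem extend_comp_self (e : Q ↪ Q') (z : Q' → Bool) : extend e (z ∘ e) z = z := by
  funext q
  by_cases h : ∃ a, e a = q
  · obtain ⟨a, rfl⟩ := h
    simp [e.injective.extend_apply]
  · rw [extend_apply' _ _ _ h]

omit [DecidableEq Q] [DecidableEq Q'] in
theorem slice_apply_comp (e : Q ↪ Q') (z : Q' → Bool) (ψ : State Q') :
    slice e z ψ (z ∘ e) = ψ z := by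
  rw [slice, extend_comp_self]

theorem update_extend (e : Q ↪ Q') (y : Q → Bool) (z : Q' → Bool) (q : Q) (b : Bool) :
    update (extend e y z) (e q) b = extend e (update y q b) z := by
  funext r
  by_cases h : ∃ a, e a = r
  · obtain ⟨a, rfl⟩ := h
    by_cases ha : a = q
    · subst ha; simp [e.injective.extend_apply]
    · simp [e.injective.extend_apply, ha]
  · have : r ≠ e q := fun hr => h ⟨q, hr.symm⟩
    rw [update_of_ne this, extend_apply' _ _ _ h, extend_apply' _ _ _ h]

theorem fanOutBits_extend (e : Q ↪ Q') (y : Q → Bool) (z : Q' → Bool) (c : Q) (T : Finset Q) :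
    fanOutBits (e c) (T.map e) (extend e y z) = extend e (fanOutBits c T y) z := by
  funext r
  by_cases h : ∃ a, e a = r
  · obtain ⟨a, rfl⟩ := h
    simp [fanOutBits, e.injective.extend_apply]
  · have : r ∉ T.map e := fun hr => by
      obtain ⟨a, -, ha⟩ := Finset.mem_map.1 hr
      exact h ⟨a, ha⟩
    rw [fanOutBits, if_neg this, extend_apply' _ _ _ h, extend_apply' _ _ _ h]

/-- A relabelled gate never touches bits outside the range of `e`. The state thus splits into
slices, one for each assignment of the outside bits, which evolve independently. -/
theorem Gate.slice_apply_map (e : Q ↪ Q') (z : Q' → Bool) (g : Gate Q) (ψ : State Q') :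
    slice e z ((g.map e).apply ψ) = g.apply (slice e z ψ) := by
  funext y
  cases g with
  | oneQubit q U =>
    simp only [slice, Gate.map, Gate.apply, update_extend, e.injective.extend_apply]
  | fanOut c T h =>
    simp only [slice, Gate.map, Gate.apply, fanOutBits_extend]

theorem Layer.slice_apply_map (e : Q ↪ Q') (z : Q' → Bool) (L : Layer Q) (ψ : State Q') :
    slice e z ((L.map e).apply ψ) = L.apply (slice e z ψ) := by
  simp only [Layer.apply, Layer.map]
  induction L.gates generalizing ψ with
  | nil => rfl
  | cons g gs ih => simp only [List.map_cons, List.foldl_cons, ih, Gate.slice_apply_map]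

theorem Circuit.slice_apply_map (e : Q ↪ Q') (z : Q' → Bool) (C : Circuit Q) (ψ : State Q') :
    slice e z (Circuit.apply (Circuit.map e C) ψ) = Circuit.apply C (slice e z ψ) := by
  simp only [Circuit.apply, Circuit.map]
  induction C generalizing ψ with
  | nil => rfl
  | cons g gs ih => simp only [List.map_cons, List.foldl_cons, ih, Layer.slice_apply_map]

theorem Gate.apply_zero (g : Gate Q) : g.apply 0 = 0 := by
  funext y
  cases g <;> simp [Gate.apply]

theorem Layer.apply_zero (L : Layer Q) : L.apply 0 = 0 := by
  simp only [Layer.apply]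
  induction L.gates with
  | nil => rfl
  | cons g gs ih => simpa only [List.foldl_cons, Gate.apply_zero] using ih

theorem Circuit.apply_zero (C : Circuit Q) : Circuit.apply C 0 = 0 := by
  simp only [Circuit.apply]
  induction C with
  | nil => rfl
  | cons g gs ih => simpa only [List.foldl_cons, Layer.apply_zero] using ih

/-- Disjointness makes the sum of the gate sizes the cardinality of a union. All later size bounds
are therefore depth times number of qubits. -/
theorem Layer.size_le_card [Fintype Q] (L : Layer Q) : L.size ≤ Fintype.card Q := by
  have key : ∀ l : List (Gate Q), l.Pairwise (fun g h => Disjoint g.qubits h.qubits) →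
      ∃ s : Finset Q, (∀ q, q ∈ s ↔ ∃ g ∈ l, q ∈ g.qubits) ∧ (l.map Gate.size).sum = s.card := by
    intro l
    induction l with
    | nil => exact fun _ => ⟨∅, by simp, by simp⟩
    | cons g gs ih =>
      intro h
      rw [List.pairwise_cons] at h
      obtain ⟨s, hs, hc⟩ := ih h.2
      refine ⟨g.qubits ∪ s, fun q => by simp [hs], ?_⟩
      rw [Finset.card_union_of_disjoint, List.map_cons, List.sum_cons, hc, Gate.size]
      rw [Finset.disjoint_left]
      intro q hq hqs
      obtain ⟨g', hg', hq'⟩ := (hs q).1 hqs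
      exact Finset.disjoint_left.1 (h.1 g' hg') hq hq'
  obtain ⟨s, -, hs⟩ := key L.gates L.disjoint
  rw [Layer.size, hs]
  exact Finset.card_le_univ s

/-! ## Operators implemented with ancillas -/

/-- The state `ψ ⊗ |0⟩` on the qubits `Q` and the ancillas `A`. -/
noncomputable def padZero {Q A : Type*} (ψ : State Q) : State (Q ⊕ A) :=
  open Classical in
  fun z => if ∀ a, z (.inr a) = false then ψ (z ∘ Sum.inl) else 0

/-- Act with `V` on the qubits in the range of `e`, and trivially on the others. -/
noncomputable def lift (e : Q ↪ Q') (V : State Q → State Q) (ψ : State Q') : State Q' :=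
  fun z => V (slice e z ψ) (z ∘ e)

/-- The claim is checked slice by slice. If all ancillas outside the range of `i` are 0, the slice
is again a padded state and the hypothesis applies. Otherwise the slice is the zero state, which
every circuit preserves. -/
theorem Circuit.apply_map_padZero {A A' : Type*} [DecidableEq A] [DecidableEq A']
    (e : Q ↪ Q') (i : A ↪ A') (C : Circuit (Q ⊕ A)) (V : State Q → State Q)
    (hC : ∀ ψ, Circuit.apply C (padZero ψ) = padZero (V ψ)) (ψ : State Q') :
    Circuit.apply (Circuit.map (e.sumMap i) C) (padZero ψ) = padZero (lift e V ψ) := by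
  classical
  have inl_ext : ∀ (y : Q ⊕ A → Bool) (z : Q' ⊕ A' → Bool),
      (extend (e.sumMap i) y z) ∘ Sum.inl = extend e (y ∘ Sum.inl) (z ∘ Sum.inl) := by
    intro y z
    funext q
    by_cases h : ∃ a, e a = q
    · obtain ⟨a, rfl⟩ := h
      have := (e.sumMap i).injective.extend_apply y z (Sum.inl a)
      simpa [e.injective.extend_apply] using this
    · rw [extend_apply' _ _ _ h, comp_apply, extend_apply', comp_apply]
      rintro ⟨a | a, ha⟩
      · exact h ⟨a, by simpa using ha⟩
      · simp at ha
  have inr_ext : ∀ (y : Q ⊕ A → Bool) (z : Q' ⊕ A' → Bool) (a : A),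
      extend (e.sumMap i) y z (Sum.inr (i a)) = y (Sum.inr a) := fun y z a =>
    (e.sumMap i).injective.extend_apply y z (Sum.inr a)
  have inr_ext' : ∀ (y : Q ⊕ A → Bool) (z : Q' ⊕ A' → Bool) (a' : A'), (¬ ∃ a, i a = a') →
      extend (e.sumMap i) y z (Sum.inr a') = z (Sum.inr a') := by
    intro y z a' ha
    rw [extend_apply']
    rintro ⟨a | a, h⟩
    · simp at h
    · exact ha ⟨a, by simpa using h⟩
  funext z
  rw [← slice_apply_comp (e.sumMap i) z (Circuit.apply _ _), Circuit.slice_apply_map]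
  by_cases hz : ∀ a', (¬ ∃ a, i a = a') → z (Sum.inr a') = false
  · have : slice (e.sumMap i) z (padZero ψ) = padZero (slice e (z ∘ Sum.inl) ψ) := by
      funext y
      simp only [slice, padZero, inl_ext]
      congr 1
      refine propext ⟨fun h a => by rw [← h (i a), inr_ext], fun h a' => ?_⟩
      by_cases ha : ∃ a, i a = a'
      · obtain ⟨a, rfl⟩ := ha
        rw [inr_ext, h]
      · rw [inr_ext' _ _ _ ha, hz _ ha]
    rw [this, hC]
    simp only [padZero, lift]
    congr 1
    refine propext ⟨fun h a' => ?_, fun h a => h (i a)⟩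
    by_cases ha : ∃ a, i a = a'
    · obtain ⟨a, rfl⟩ := ha
      exact h a
    · exact hz _ ha
  · have : slice (e.sumMap i) z (padZero ψ) = 0 := by
      funext y
      simp only [slice, padZero, Pi.zero_apply]
      rw [if_neg]
      intro h
      exact hz fun a' ha => by rw [← inr_ext' y z a' ha, h]
    rw [this, Circuit.apply_zero, padZero, if_neg, Pi.zero_apply]
    exact fun h => hz fun a' _ => h a'

/-- The operator `V` is implemented by a circuit of depth at most `D` and size at most `S`, with
ancillas that start and end in `|0⟩`. -/
def Impl {Q : Type} [DecidableEq Q] (V : State Q → State Q) (D S : ℕ) : Prop :=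
  ∃ (A : Type) (_ : Fintype A) (_ : DecidableEq A) (C : Circuit (Q ⊕ A)),
    (∀ ψ, Circuit.apply C (padZero ψ) = padZero (V ψ)) ∧
      Circuit.depth C ≤ D ∧ Circuit.size C ≤ S

/-! ### Calculus of operators implementable with clean ancillas -/

section Impl

variable {R R' : Type} [DecidableEq R] [DecidableEq R']

theorem Impl.mono {V : State R → State R} {D S D' S' : ℕ} (h : Impl V D S) (hD : D ≤ D')
    (hS : S ≤ S') : Impl V D' S' := by
  obtain ⟨A, _, _, C, hC, h1, h2⟩ := h
  exact ⟨A, ‹_›, ‹_›, C, hC, h1.trans hD, h2.trans hS⟩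

theorem Impl.lift {V : State R → State R} {D S : ℕ} (h : Impl V D S) (e : R ↪ R') :
    Impl (lift e V) D S := by
  obtain ⟨A, _, _, C, hC, h1, h2⟩ := h
  refine ⟨A, ‹_›, ‹_›, Circuit.map (e.sumMap (Embedding.refl A)) C,
    Circuit.apply_map_padZero e _ C V hC, ?_, ?_⟩
  · rwa [Circuit.depth_map]
  · rwa [Circuit.size_map]

omit [DecidableEq R] in
theorem lift_refl (V : State R → State R) : lift (Embedding.refl R) V = V := by
  funext ψ z
  have : slice (Embedding.refl R) z ψ = ψ := by
    funext y
    exact congrArg ψ (funext fun q => (Embedding.refl R).injective.extend_apply y z q)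
  rw [FanOutCircuit.lift, this]
  rfl

theorem Impl.comp {V W : State R → State R} {D S D' S' : ℕ} (hV : Impl V D S)
    (hW : Impl W D' S') : Impl (fun ψ => W (V ψ)) (D + D') (S + S') := by
  obtain ⟨A, _, _, C, hC, h1, h2⟩ := hV
  obtain ⟨A', _, _, C', hC', h1', h2'⟩ := hW
  refine ⟨A ⊕ A', inferInstance, inferInstance,
    Circuit.map ((Embedding.refl R).sumMap Embedding.inl) C ++
      Circuit.map ((Embedding.refl R).sumMap Embedding.inr) C', fun ψ => ?_, ?_, ?_⟩
  · have e1 := Circuit.apply_map_padZero (Embedding.refl R) (Embedding.inl : A ↪ A ⊕ A') C V hC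
    have e2 := Circuit.apply_map_padZero (Embedding.refl R) (Embedding.inr : A' ↪ A ⊕ A') C' W hC'
    rw [lift_refl] at e1 e2
    rw [Circuit.apply, List.foldl_append]
    exact (congrArg _ (e1 ψ)).trans (e2 _)
  · have e1 := Circuit.depth_map ((Embedding.refl R).sumMap (Embedding.inl : A ↪ A ⊕ A')) C
    have e2 := Circuit.depth_map ((Embedding.refl R).sumMap (Embedding.inr : A' ↪ A ⊕ A')) C'
    simp only [Circuit.depth, List.length_append] at *
    omega
  · have e1 := Circuit.size_map ((Embedding.refl R).sumMap (Embedding.inl : A ↪ A ⊕ A')) C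
    have e2 := Circuit.size_map ((Embedding.refl R).sumMap (Embedding.inr : A' ↪ A ⊕ A')) C'
    simp only [Circuit.size, List.map_append, List.sum_append] at *
    omega

/-- Qubits that start and end in `|0⟩` can be regarded as ancillas. -/
theorem Impl.absorb {Y : Type} [DecidableEq Y] [Fintype Y] {W : State (R ⊕ Y) → State (R ⊕ Y)}
    {V : State R → State R} {D S : ℕ} (h : Impl W D S)
    (hV : ∀ ψ, W (padZero ψ) = padZero (V ψ)) : Impl V D S := by
  obtain ⟨A, _, _, C, hC, h1, h2⟩ := h
  set e : (R ⊕ Y) ⊕ A ↪ R ⊕ (Y ⊕ A) := (Equiv.sumAssoc R Y A).toEmbedding with he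
  have hs : ∀ (ψ : State R) z, slice e z (padZero ψ) = padZero (padZero ψ) := by
    intro ψ z
    funext y
    have hx : ∀ q, extend e y z (e q) = y q := fun q => e.injective.extend_apply y z q
    have h0 : (extend e y z) ∘ Sum.inl = y ∘ Sum.inl ∘ Sum.inl :=
      funext fun q => hx (Sum.inl (Sum.inl q))
    have h3 : ∀ a, extend e y z (Sum.inr (Sum.inl a)) = y (Sum.inl (Sum.inr a)) :=
      fun a => hx (Sum.inl (Sum.inr a))
    have h4 : ∀ a, extend e y z (Sum.inr (Sum.inr a)) = y (Sum.inr a) :=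
      fun a => hx (Sum.inr a)
    simp only [slice, padZero, Sum.forall, h0, h3, h4, comp_apply, ite_and]
    by_cases hA : ∀ a, y (Sum.inr a) = false <;>
      by_cases hY : ∀ a, y (Sum.inl (Sum.inr a)) = false <;> (simp [hA, hY]; try rfl)
  refine ⟨Y ⊕ A, inferInstance, inferInstance, Circuit.map e C, fun ψ => ?_, ?_, ?_⟩
  · funext z
    rw [← slice_apply_comp e z (Circuit.apply _ _), Circuit.slice_apply_map, hs, hC, hV,
      ← hs _ z, slice_apply_comp]
  · rwa [Circuit.depth_map]
  · rwa [Circuit.size_map]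

/-- A layer implements itself. -/
theorem Layer.impl [Fintype R] (L : Layer R) : Impl L.apply 1 (Fintype.card R) := by
  refine ⟨Empty, inferInstance, inferInstance, [L.map Embedding.inl], fun ψ => ?_, ?_, ?_⟩
  · have hp : ∀ (ψ : State R) z, slice Embedding.inl z (padZero (A := Empty) ψ) = ψ := by
      intro ψ z
      funext y
      have : extend (Embedding.inl : R ↪ R ⊕ Empty) y z ∘ Sum.inl = y :=
        funext fun q => (Embedding.inl : R ↪ R ⊕ Empty).injective.extend_apply y z q
      simp [slice, padZero, this]
    funext z
    rw [← slice_apply_comp Embedding.inl z (Circuit.apply _ _)]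
    simp only [Circuit.apply, List.foldl_cons, List.foldl_nil]
    rw [Layer.slice_apply_map, hp, ← slice_apply_comp Embedding.inl z (padZero _), hp]
  · simp [Circuit.depth]
  · simpa [Circuit.size, Layer.size_map] using L.size_le_card

end Impl

end FanOutCircuit

/-! ## One-qubit operators with varying coefficients -/

namespace FanOutCircuit

open Function

section Loc

variable {Q : Type*} [DecidableEq Q]

/-- Flip the bit `t`. -/
def flip (t : Q) (z : Q → Bool) : Q → Bool := update z t (!z t)

@[simp]
theorem flip_self (t : Q) (z : Q → Bool) : flip t z t = !z t := by simp [flip]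

theorem flip_of_ne {s t : Q} (h : s ≠ t) (z : Q → Bool) : flip t z s = z s := by
  simp [flip, h]

@[simp]
theorem flip_flip (t : Q) (z : Q → Bool) : flip t (flip t z) = z := by simp [flip]

theorem flip_comm (s t : Q) (z : Q → Bool) : flip s (flip t z) = flip t (flip s z) := by
  funext q
  by_cases h1 : q = s <;> by_cases h2 : q = t
  · subst h1; subst h2; rfl
  · subst h1; simp [flip_of_ne h2]
  · subst h2; simp [flip_of_ne h1]
  · simp [flip_of_ne h1, flip_of_ne h2]

/-- The function `a` does not depend on the bit `t`. -/
def Indep {α : Type*} (t : Q) (a : (Q → Bool) → α) : Prop := ∀ z, a (flip t z) = a z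

theorem Indep.update_eq {α : Type*} {t : Q} {a : (Q → Bool) → α} (h : Indep t a) (z : Q → Bool)
    (b : Bool) : a (update z t b) = a z := by
  by_cases hb : b = z t
  · rw [hb, update_eq_self]
  · have : update z t b = flip t z := by
      rw [flip]
      congr 1
      revert hb
      cases b <;> cases z t <;> simp
    rw [this, h z]

theorem indep_list_eq {α : Type*} {T : List Q} {a : (Q → Bool) → α} (h : ∀ t ∈ T, Indep t a)
    (w z : Q → Bool) : a (fun q => if q ∈ T then w q else z q) = a z := by
  induction T with
  | nil => simp
  | cons t T ih =>
    rw [← ih fun s hs => h s (List.mem_cons_of_mem _ hs),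
      ← (h t List.mem_cons_self).update_eq (fun q => if q ∈ T then w q else z q) (w t)]
    congr 1
    funext q
    by_cases hq : q = t
    · subst hq; simp
    · simp [hq]

/-- The operator that mixes each amplitude with the one at the string with bit `t` flipped. -/
def loc (t : Q) (a b : (Q → Bool) → ℂ) (ψ : State Q) : State Q :=
  fun z => a z * ψ z + b z * ψ (flip t z)

theorem loc_commute {s t : Q} {a b a' b' : (Q → Bool) → ℂ} (ha : Indep t a)
    (hb : Indep t b) (ha' : Indep s a') (hb' : Indep s b') :
    Function.Commute (loc s a b) (loc t a' b') := by
  intro ψ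
  funext z
  simp only [loc, ha _, hb _, ha' _, hb' _, flip_comm t s z]
  ring

/-- Pointwise multiplication by `d`. -/
def diag (d : (Q → Bool) → ℂ) (ψ : State Q) : State Q := fun z => d z * ψ z

theorem loc_commute_diag {t : Q} {a b d : (Q → Bool) → ℂ} (hd : Indep t d) :
    Function.Commute (loc t a b) (diag d) := by
  intro ψ
  funext z
  simp only [loc, diag, hd _]
  ring

/-- The sign `(-1)^b`. -/
def sgn (b : Bool) : ℂ := if b then -1 else 1

@[simp] theorem sgn_true : sgn true = -1 := by simp [sgn]

@[simp] theorem sgn_false : sgn false = 1 := by simp [sgn]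

theorem sgn_xor (a b : Bool) : sgn (xor a b) = sgn a * sgn b := by
  cases a <;> cases b <;> simp

theorem sgn_injective : Function.Injective sgn := by
  intro a b h
  cases a <;> cases b <;> first | rfl | norm_num at h

/-- `1 / √2`. -/
noncomputable def rsqrtTwo : ℂ := ((Real.sqrt 2)⁻¹ : ℝ)

theorem rsqrtTwo_mul_self : rsqrtTwo * rsqrtTwo = 1 / 2 := by
  rw [rsqrtTwo, ← Complex.ofReal_mul, ← mul_inv, Real.mul_self_sqrt (by norm_num)]
  norm_num

/-- The Hadamard operator on the qubit `t`. -/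
noncomputable def had (t : Q) : State Q → State Q :=
  loc t (fun z => sgn (z t) * rsqrtTwo) (fun _ => rsqrtTwo)

/-- The operator `H diag(1, e) H` on the qubit `t`, with a phase `e` that depends on the other
bits. -/
noncomputable def mix (t : Q) (e : (Q → Bool) → ℂ) : State Q → State Q :=
  loc t (fun z => (1 + e z) / 2) (fun z => (1 - e z) / 2)

theorem indep_sgn {s t : Q} (h : s ≠ t) : Indep s fun z : Q → Bool => sgn (z t) * rsqrtTwo :=
  fun z => by simp only [flip_of_ne h.symm]

theorem had_commute {s t : Q} (h : s ≠ t) : Function.Commute (had s) (had t) :=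
  loc_commute (indep_sgn h.symm) (fun _ => rfl) (indep_sgn h) (fun _ => rfl)

theorem had_commute_mix {s t : Q} (h : s ≠ t) {e : (Q → Bool) → ℂ} (he : Indep s e) :
    Function.Commute (had s) (mix t e) :=
  loc_commute (indep_sgn h.symm) (fun _ => rfl) (fun z => by simp only [he z])
    (fun z => by simp only [he z])

theorem mix_commute {s t : Q} {e e' : (Q → Bool) → ℂ} (he : Indep t e)
    (he' : Indep s e') : Function.Commute (mix s e) (mix t e') :=
  loc_commute (fun z => by simp only [he z]) (fun z => by simp only [he z])
    (fun z => by simp only [he' z]) (fun z => by simp only [he' z])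

/-- The phase `e` conditioned on the bit `t`. -/
def ctrl (t : Q) (e : (Q → Bool) → ℂ) : (Q → Bool) → ℂ := fun z => if z t then e z else 1

theorem had_diag_had {t : Q} {e : (Q → Bool) → ℂ} (he : Indep t e) (ψ : State Q) :
    had t (diag (ctrl t e) (had t ψ)) = mix t e ψ := by
  funext z
  have h := rsqrtTwo_mul_self
  simp only [had, mix, loc, diag, ctrl, he _, flip_flip, flip_self]
  cases z t <;> simp <;>
    linear_combination (ψ z + e z * ψ z + ψ (flip t z) - e z * ψ (flip t z)) * h

theorem diag_commute_had {s t : Q} (h : s ≠ t) {e : (Q → Bool) → ℂ} (he : Indep s e) :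
    Function.Commute (diag (ctrl t e)) (had s) :=
  (loc_commute_diag fun z => by simp only [ctrl, flip_of_ne h.symm, he z]).symm

theorem diag_commute_mix {s t : Q} (h : s ≠ t) {e e' : (Q → Bool) → ℂ} (he : Indep s e) :
    Function.Commute (diag (ctrl t e)) (mix s e') :=
  (loc_commute_diag fun z => by simp only [ctrl, flip_of_ne h.symm, he z]).symm

omit [DecidableEq Q] in
theorem diag_diag (d d' : (Q → Bool) → ℂ) (ψ : State Q) :
    diag d (diag d' ψ) = diag (fun z => d z * d' z) ψ := by
  funext z
  simp only [diag, mul_assoc]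

/-! ## Lists of one-qubit operators -/

/-- Apply the operators `f t`, for `t` in the list `T`. -/
def opAll (T : List Q) (f : Q → State Q → State Q) (ψ : State Q) : State Q :=
  T.foldl (fun φ t => f t φ) ψ

omit [DecidableEq Q] in
theorem opAll_cons (t : Q) (T : List Q) (f : Q → State Q → State Q) (ψ : State Q) :
    opAll (t :: T) f ψ = opAll T f (f t ψ) := rfl

omit [DecidableEq Q] in
theorem opAll_append (T T' : List Q) (f : Q → State Q → State Q) (ψ : State Q) :
    opAll (T ++ T') f ψ = opAll T' f (opAll T f ψ) := by
  simp [opAll]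

omit [DecidableEq Q] in
theorem opAll_commute {T : List Q} {f : Q → State Q → State Q} {A : State Q → State Q}
    (h : ∀ t ∈ T, Function.Commute A (f t)) : Function.Commute A (opAll T f) := by
  induction T with
  | nil => exact fun _ => rfl
  | cons t T ih =>
    intro ψ
    rw [opAll_cons, opAll_cons, ih (fun s hs => h s (List.mem_cons_of_mem _ hs)),
      h t List.mem_cons_self]

omit [DecidableEq Q] in
theorem opAll_congr {T : List Q} {f g : Q → State Q → State Q} (h : ∀ t ∈ T, f t = g t) :
    opAll T f = opAll T g := by
  funext ψ
  induction T generalizing ψ with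
  | nil => rfl
  | cons t T ih =>
    rw [opAll_cons, opAll_cons, ih (fun s hs => h s (List.mem_cons_of_mem _ hs)),
      h t List.mem_cons_self]

/-- As no phase `e t` depends on a bit of `T`, the factor for one qubit commutes with the Hadamards
and `mix` operators of the others. The sandwich then splits into one-qubit sandwiches. -/
theorem had_diag_had_all {T : List Q} (hT : T.Nodup) {e : Q → (Q → Bool) → ℂ}
    (he : ∀ s ∈ T, ∀ t ∈ T, Indep s (e t)) (ψ : State Q) :
    opAll T had (diag (fun z => (T.map fun t => ctrl t (e t) z).prod) (opAll T had ψ)) =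
      opAll T (fun t => mix t (e t)) ψ := by
  induction T generalizing ψ with
  | nil =>
    funext z
    simp [opAll, diag]
  | cons t T ih =>
    rw [List.nodup_cons] at hT
    have hne : ∀ s ∈ T, s ≠ t := fun s hs h => hT.1 (h ▸ hs)
    have hs' : ∀ s ∈ T, s ∈ t :: T := fun s hs => List.mem_cons_of_mem _ hs
    have ht : t ∈ t :: T := List.mem_cons_self
    have c1 : Function.Commute (fun φ => had t (diag (ctrl t (e t)) φ)) (opAll T had) :=
      opAll_commute fun s hs φ => by
        rw [diag_commute_had (hne s hs) (he s (hs' s hs) t ht), had_commute (hne s hs).symm]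
    have c2 : Function.Commute (fun φ => had t (diag (ctrl t (e t)) φ))
        (opAll T fun s => mix s (e s)) :=
      opAll_commute fun s hs φ => by
        rw [diag_commute_mix (hne s hs) (he s (hs' s hs) t ht),
          had_commute_mix (hne s hs).symm (he t ht s (hs' s hs))]
    simp only [List.map_cons, List.prod_cons, opAll_cons]
    rw [← diag_diag, ← c1, ih hT.2 fun s hs u hu => he s (hs' s hs) u (hs' u hu)]
    have := c2 (had t ψ)
    beta_reduce at this ⊢
    rw [this, had_diag_had (he t ht t ht)]

theorem mix_one (t : Q) (ψ : State Q) : mix t (fun _ => 1) ψ = ψ := by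
  funext z
  simp [mix, loc]

theorem had_all_had_all {T : List Q} (hT : T.Nodup) (ψ : State Q) :
    opAll T had (opAll T had ψ) = ψ := by
  have h := had_diag_had_all hT (e := fun _ _ => 1) (fun _ _ _ _ _ => rfl) ψ
  have h1 : ∀ φ : State Q, diag (fun z => (T.map fun t => ctrl t (fun _ => 1) z).prod) φ = φ := by
    intro φ
    funext z
    simp [diag, ctrl]
  rw [h1] at h
  rw [h]
  clear h h1 hT
  induction T generalizing ψ with
  | nil => rfl
  | cons t T ih => rw [opAll_cons, mix_one, ih]

/-- In the Hadamard basis of `t` the operator is `diag(1, e)`, whose inverse has `e⁻¹` in place of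
`e`. -/
theorem mix_inv_mix {t : Q} {e : (Q → Bool) → ℂ} (he : Indep t e) (h0 : ∀ z, e z ≠ 0)
    (ψ : State Q) : mix t (fun z => (e z)⁻¹) (mix t e ψ) = ψ := by
  funext z
  have := h0 z
  simp only [mix, loc, he _, flip_flip]
  field_simp
  ring

theorem mix_inv_mix_all {T : List Q} (hT : T.Nodup) {e : Q → (Q → Bool) → ℂ}
    (he : ∀ s ∈ T, ∀ t ∈ T, Indep s (e t)) (h0 : ∀ t z, e t z ≠ 0) (ψ : State Q) :
    opAll T (fun t => mix t fun z => (e t z)⁻¹) (opAll T (fun t => mix t (e t)) ψ) = ψ := by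
  induction T generalizing ψ with
  | nil => rfl
  | cons t T ih =>
    rw [List.nodup_cons] at hT
    have hs' : ∀ s ∈ T, s ∈ t :: T := fun s hs => List.mem_cons_of_mem _ hs
    have ht : t ∈ t :: T := List.mem_cons_self
    have c : Function.Commute (mix t fun z => (e t z)⁻¹) (opAll T fun s => mix s (e s)) :=
      opAll_commute fun s hs =>
        mix_commute (fun z => by simp only [he s (hs' s hs) t ht z]) (he t ht s (hs' s hs))
    rw [opAll_cons, opAll_cons, c, mix_inv_mix (he t ht t ht) (h0 t),
      ih hT.2 fun s hs u hu => he s (hs' s hs) u (hs' u hu)]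

/-- Conditional bit flips: the bit `q` is flipped if `q ∈ T` and `f q` holds. -/
def flips (T : List Q) (f : Q → (Q → Bool) → Bool) (z : Q → Bool) : Q → Bool :=
  fun q => if q ∈ T then xor (z q) (f q z) else z q

theorem mix_all_eq_flips {T : List Q} (hT : T.Nodup) {f : Q → (Q → Bool) → Bool}
    (hf : ∀ s ∈ T, ∀ t ∈ T, Indep s (f t)) (ψ : State Q) (z : Q → Bool) :
    opAll T (fun t => mix t fun z => sgn (f t z)) ψ z = ψ (flips T f z) := by
  induction T generalizing ψ with
  | nil =>
    have : flips [] f z = z := by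
      funext q
      simp [flips]
    rw [this]
    rfl
  | cons t T ih =>
    rw [List.nodup_cons] at hT
    have hs' : ∀ s ∈ T, s ∈ t :: T := fun s hs => List.mem_cons_of_mem _ hs
    have ht : t ∈ t :: T := List.mem_cons_self
    rw [opAll_cons, ih hT.2 fun s hs u hu => hf s (hs' s hs) u (hs' u hu)]
    -- The other flips only change bits of `T`, which `f t` does not see.
    have hft : f t (flips T f z) = f t z :=
      indep_list_eq (fun s hs => hf s (hs' s hs) t ht) (fun q => xor (z q) (f q z)) z
    simp only [mix, loc, hft]
    have hz : flips (t :: T) f z = if f t z then flip t (flips T f z) else flips T f z := by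
      funext q
      by_cases hq : q = t
      · subst hq
        cases hfq : f q z <;> simp [flips, hT.1, hfq]
      · split_ifs <;> simp [flips, flip_of_ne hq, hq]
    rw [hz]
    cases f t z <;> simp

/-- Amplitudes that survive the operators `mix t (e t)` on a state with all bits in `T` zero. -/
theorem support_mix_all {T : List Q} (hT : T.Nodup) {e : Q → (Q → Bool) → ℂ}
    (he : ∀ s ∈ T, ∀ t ∈ T, Indep s (e t)) {ψ : State Q}
    (hψ : ∀ z, ψ z ≠ 0 → ∀ t ∈ T, z t = false) (z : Q → Bool)
    (hz : opAll T (fun t => mix t (e t)) ψ z ≠ 0) (t : Q) (ht : t ∈ T) :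
    (z t = true → e t z ≠ 1) ∧ (z t = false → e t z ≠ -1) := by
  -- A support condition that ignores the bits of `T` survives all operators on `T`. So only the
  -- operator on `t` itself has to be inspected: from a bit 0, its amplitudes are `(1 + e) / 2` at 0
  -- and `(1 - e) / 2` at 1.
  have pres : ∀ (T : List Q) (P : (Q → Bool) → Prop), (∀ s ∈ T, Indep s P) → ∀ ψ : State Q,
      (∀ z, ψ z ≠ 0 → P z) → ∀ z, opAll T (fun t => mix t (e t)) ψ z ≠ 0 → P z := by
    intro T P
    induction T with
    | nil => exact fun _ _ h => h
    | cons s T ih =>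
      intro hP ψ h
      refine ih (fun s hs => hP s (List.mem_cons_of_mem _ hs)) _ fun z hz => ?_
      by_contra hPz
      have h1 : ψ z = 0 := not_not.1 fun h' => hPz (h z h')
      have h2 : ψ (flip s z) = 0 := not_not.1 fun h' => hPz (by
        rw [← hP s List.mem_cons_self z]; exact h _ h')
      exact hz (by simp [mix, loc, h1, h2])
  induction T generalizing ψ with
  | nil => simp at ht
  | cons s T ih =>
    rw [List.nodup_cons] at hT
    have hs' : ∀ s' ∈ T, s' ∈ s :: T := fun s' hs => List.mem_cons_of_mem _ hs
    have hs : s ∈ s :: T := List.mem_cons_self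
    rw [opAll_cons] at hz
    rcases List.mem_cons.1 ht with rfl | ht
    · refine pres T (fun z => (z t = true → e t z ≠ 1) ∧ (z t = false → e t z ≠ -1))
        (fun s' h' z => ?_) _ (fun z hz => ?_) z hz
      · have : t ≠ s' := fun h => hT.1 (h ▸ h')
        simp only [flip_of_ne this, he s' (hs' s' h') t hs z]
      · constructor
        · intro hzt h1
          have : ψ z = 0 := not_not.1 fun h => by simp [hψ z h t hs] at hzt
          exact hz (by simp [mix, loc, this, h1])
        · intro hzt h1
          have : ψ (flip t z) = 0 := not_not.1 fun h => by
            have := hψ _ h t hs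
            simp [hzt] at this
          exact hz (by simp [mix, loc, this, h1])
    · refine ih hT.2 (fun s hs u hu => he s (hs' s hs) u (hs' u hu)) (fun z hz u hu => ?_) hz ht
      have hus : u ≠ s := fun h => hT.1 (h ▸ hu)
      by_contra hzu
      have h1 : ψ z = 0 := not_not.1 fun h => hzu (hψ z h u (hs' u hu))
      have h2 : ψ (flip s z) = 0 := not_not.1 fun h => hzu (by
        have := hψ _ h u (hs' u hu)
        rwa [flip_of_ne hus] at this)
      exact hz (by simp [mix, loc, h1, h2])

end Loc

end FanOutCircuit

/-! ## Layers of Hadamard, phase and fan-out gates -/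

namespace FanOutCircuit

section Gates

variable {Q : Type*} [DecidableEq Q]

/-- The Hadamard gate. -/
noncomputable def hadU : Matrix.unitaryGroup Bool ℂ :=
  ⟨Matrix.of fun a b => sgn (a && b) * rsqrtTwo, by
    have h := rsqrtTwo_mul_self
    have hs : star rsqrtTwo = rsqrtTwo := Complex.conj_ofReal _
    rw [Matrix.mem_unitaryGroup_iff]
    ext a b
    cases a <;> cases b <;> simp [Matrix.mul_apply, Matrix.star_apply, hs, h]
    all_goals norm_num⟩

/-- The phase gate `diag(1, u)`. -/
noncomputable def phaseU (u : ℂ) (hu : ‖u‖ = 1) : Matrix.unitaryGroup Bool ℂ :=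
  ⟨Matrix.diagonal fun b => if b then u else 1, by
    rw [Matrix.mem_unitaryGroup_iff]
    ext a b
    cases a <;> cases b <;> simp [Matrix.star_eq_conjTranspose, Complex.mul_conj,
      Complex.normSq_eq_norm_sq, hu]⟩

theorem apply_hadU (q : Q) : (Gate.oneQubit q hadU).apply = had q := by
  funext ψ z
  have h : ∀ b, Function.update z q b = if b = z q then z else flip q z := by
    intro b
    split_ifs with hb
    · rw [hb, Function.update_eq_self]
    · rw [flip]
      congr 1
      revert hb
      cases b <;> cases z q <;> simp
  simp only [Gate.apply, hadU, had, loc, Fintype.sum_bool, h, Matrix.of_apply]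
  cases z q <;> simp [add_comm]

theorem apply_phaseU (q : Q) (u : ℂ) (hu : ‖u‖ = 1) :
    (Gate.oneQubit q (phaseU u hu)).apply = diag (ctrl q fun _ => u) := by
  funext ψ z
  simp only [Gate.apply, phaseU, diag, ctrl, Fintype.sum_bool]
  cases h : z q
  · rw [← h, Function.update_eq_self]; simp [h]
  · rw [← h, Function.update_eq_self]; simp [h]

/-- A layer of one-qubit gates on the qubits in the list `T`. -/
def oneQubitLayer (T : List Q) (hT : T.Nodup) (U : Q → Matrix.unitaryGroup Bool ℂ) : Layer Q where
  gates := T.map fun q => .oneQubit q (U q)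
  disjoint := by
    rw [List.pairwise_map]
    exact hT.imp fun h => Finset.disjoint_singleton.2 h

theorem apply_oneQubitLayer (T : List Q) (hT : T.Nodup) (U : Q → Matrix.unitaryGroup Bool ℂ) :
    (oneQubitLayer T hT U).apply = opAll T fun q => (Gate.oneQubit q (U q)).apply := by
  funext ψ
  simp only [Layer.apply, oneQubitLayer, opAll, List.foldl_map]

omit [DecidableEq Q] in
theorem opAll_diag (T : List Q) (d : Q → (Q → Bool) → ℂ) (ψ : State Q) :
    opAll T (fun t => diag (d t)) ψ = diag (fun z => (T.map fun t => d t z).prod) ψ := by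
  induction T generalizing ψ with
  | nil =>
    funext z
    simp [opAll, diag]
  | cons t T ih =>
    rw [opAll_cons, ih, diag_diag]
    congr 1
    funext z
    rw [List.map_cons, List.prod_cons, mul_comm]

/-- Add the bit `p q` to the bit `q`, for all `q` that are not fixed by `p`. -/
def fanBits (p : Q → Q) (z : Q → Bool) : Q → Bool :=
  fun q => if p q = q then z q else xor (z q) (z (p q))

variable [Fintype Q]

/-- A layer of fan-out gates in which `p q` is the control of the target `q`. -/
noncomputable def fanLayer (p : Q → Q) : Layer Q where
  gates := (Finset.univ.filter fun c => p c = c).toList.map fun c =>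
    .fanOut c (Finset.univ.filter fun q => p q = c ∧ q ≠ c) (by simp)
  disjoint := by
    have hn := Finset.nodup_toList (Finset.univ.filter fun c => p c = c)
    rw [List.pairwise_map]
    refine hn.imp_of_mem fun {c d} hc hd hcd => ?_
    simp only [Finset.mem_toList, Finset.mem_filter_univ] at hc hd
    simp only [Gate.qubits, Finset.disjoint_left, Finset.mem_insert, Finset.mem_filter_univ]
    rintro a (rfl | ⟨rfl, h⟩) (h' | ⟨h', h''⟩)
    · exact hcd h'
    · exact hcd (hc.symm.trans h')
    · exact hcd (by rw [h', hd])
    · exact hcd h'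

theorem apply_fanLayer {p : Q → Q} (hp : ∀ q, p (p q) = p q) (ψ : State Q) :
    (fanLayer p).apply ψ = fun z => ψ (fanBits p z) := by
  -- Induction on the controls already processed. Controls are fixed points of `p` and never
  -- targets, so their values do not change along the way.
  have key : ∀ (cs : List Q), cs.Nodup → (∀ c ∈ cs, p c = c) → ∀ ψ : State Q,
      (cs.map fun c => Gate.fanOut c (Finset.univ.filter fun q => p q = c ∧ q ≠ c)
        (by simp)).foldl (fun φ g => g.apply φ) ψ =
      fun z => ψ fun q => if p q ∈ cs ∧ p q ≠ q then xor (z q) (z (p q)) else z q := by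
    intro cs
    induction cs with
    | nil => intros; simp
    | cons c cs ih =>
      intro hn hc ψ
      rw [List.nodup_cons] at hn
      rw [List.map_cons, List.foldl_cons, ih hn.2 fun c hc' => hc c (List.mem_cons_of_mem _ hc')]
      funext z
      simp only [Gate.apply]
      congr 1
      funext q
      have hcc := hc c List.mem_cons_self
      by_cases hq : p q = c ∧ q ≠ c
      · have hpq : p q ≠ q := fun h => hq.2 (h ▸ hq.1)
        have : c ≠ q := hq.2.symm
        simp [fanOutBits, hq.1, hn.1, hcc, hq.2, this]
      · have : (p q ∈ c :: cs ∧ p q ≠ q) ↔ (p q ∈ cs ∧ p q ≠ q) := by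
          rw [List.mem_cons]
          refine ⟨fun h => ⟨h.1.resolve_left fun h' => hq ⟨h', fun h'' => h.2 ?_⟩, h.2⟩,
            fun h => ⟨Or.inr h.1, h.2⟩⟩
          rw [h', h'']
        simp only [fanOutBits, Finset.mem_filter_univ, hq, if_false, this]
  rw [Layer.apply, fanLayer, key _ (Finset.nodup_toList _) (by simp)]
  funext z
  congr 1
  funext q
  by_cases h : p q = q <;> simp [fanBits, hp, h]

end Gates

/-! ## Parities -/

section Parity

variable {Q : Type*} [DecidableEq Q]

instance : Std.Commutative xor := ⟨Bool.xor_comm⟩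

instance : Std.Associative xor := ⟨Bool.xor_assoc⟩

/-- The parity of the bits in `S`. -/
def par {Q : Type*} (S : Finset Q) (z : Q → Bool) : Bool := S.fold xor false z

theorem par_insert {S : Finset Q} {t : Q} (ht : t ∉ S) (z : Q → Bool) :
    par (insert t S) z = xor (z t) (par S z) := Finset.fold_insert ht

omit [DecidableEq Q] in
theorem par_singleton (t : Q) (z : Q → Bool) : par {t} z = z t := by
  simp [par]

theorem sgn_par (S : Finset Q) (z : Q → Bool) : sgn (par S z) = ∏ q ∈ S, sgn (z q) := by
  induction S using Finset.induction_on with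
  | empty => simp [par]
  | insert t S ht ih => rw [par_insert ht, sgn_xor, ih, Finset.prod_insert ht]

omit [DecidableEq Q] in
theorem par_congr {S : Finset Q} {y z : Q → Bool} (h : ∀ q ∈ S, y q = z q) : par S y = par S z :=
  Finset.fold_congr h

variable [Fintype Q]

/-- Add to each bit `c` that is fixed by `p` the bits `q ≠ c` with `p q = c`. -/
def parBits (p : Q → Q) (z : Q → Bool) : Q → Bool := fun c =>
  if p c = c then xor (z c) (par (Finset.univ.filter fun q => p q = c ∧ q ≠ c) z) else z c

/-- The list of qubits satisfying a predicate. -/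
noncomputable def qubitList (P : Q → Prop) [DecidablePred P] : List Q :=
  (Finset.univ.filter P).toList

omit [DecidableEq Q] in
theorem nodup_qubitList (P : Q → Prop) [DecidablePred P] : (qubitList P).Nodup :=
  Finset.nodup_toList _

omit [DecidableEq Q] in
@[simp]
theorem mem_qubitList {P : Q → Prop} [DecidablePred P] {q : Q} : q ∈ qubitList P ↔ P q := by
  simp [qubitList]

omit [DecidableEq Q] in
theorem prod_qubitList (P : Q → Prop) [DecidablePred P] (f : Q → ℂ) :
    ((qubitList P).map f).prod = ∏ q with P q, f q :=
  Finset.prod_map_toList _ f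

/-- Hadamards on both ends of a controlled-not exchange control and target. A fan-out from `c` thus
becomes the addition to `c` of the parity of its former targets. -/
theorem had_fan_had {p : Q → Q} (hp : ∀ q, p (p q) = p q) (ψ : State Q) :
    opAll ((qubitList fun q => p q ≠ q) ++ qubitList fun q => p q = q) had
      (fun z => opAll ((qubitList fun q => p q = q) ++ qubitList fun q => p q ≠ q) had ψ
        (fanBits p z)) =
      fun z => ψ (parBits p z) := by
  have hT := nodup_qubitList fun q => p q ≠ q
  have hR := nodup_qubitList fun q => p q = q
  set φ := opAll (qubitList fun q => p q = q) had ψ with hφ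
  have hfan : ∀ χ : State Q, (fun z => χ (fanBits p z)) =
      opAll (qubitList fun q => p q ≠ q) (fun t => mix t fun z => sgn (z (p t))) χ := by
    intro χ
    funext z
    rw [mix_all_eq_flips hT (f := fun t z => z (p t)) fun s hs t ht z => flip_of_ne
      (fun h => mem_qubitList.1 hs (by rw [← h, hp])) z]
    congr 1
    funext q
    by_cases h : p q = q <;> simp [fanBits, flips, h]
  -- The sign `(-1) ^ (z t * z (p t))` is symmetric in its two bits. Grouping the factors by the
  -- fibres of `p` makes the former controls the targets, with the parity of the fibre as condition.
  have hD : (fun z => ((qubitList fun q => p q ≠ q).map fun t =>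
      ctrl t (fun z => sgn (z (p t))) z).prod) =
      fun z => ((qubitList fun q => p q = q).map fun c =>
        ctrl c (fun z => sgn (par (Finset.univ.filter fun q => p q = c ∧ q ≠ c) z)) z).prod := by
    funext z
    rw [prod_qubitList, prod_qubitList]
    have h1 : ∀ c, ctrl c (fun z => sgn (par (Finset.univ.filter fun q => p q = c ∧ q ≠ c) z)) z =
        ∏ t with p t = c ∧ t ≠ c, ctrl c (fun z => sgn (z t)) z := by
      intro c
      simp only [ctrl, sgn_par]
      cases z c <;> simp
    rw [← Finset.prod_fiberwise_of_maps_to (t := Finset.univ.filter fun q => p q = q) (g := p)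
      (by simp [hp])]
    refine Finset.prod_congr rfl fun c hc => ?_
    rw [h1, Finset.filter_filter]
    refine Finset.prod_congr ?_ fun t ht => ?_
    · ext t
      simp only [Finset.mem_filter_univ]
      refine ⟨fun h => ⟨h.2, fun h' => h.1 (by rw [h.2, h'])⟩,
        fun h => ⟨fun h' => h.2 (h'.symm.trans h.1), h.1⟩⟩
    · simp only [Finset.mem_filter_univ] at ht
      simp only [ctrl, ht.1]
      cases z t <;> cases z c <;> simp
  have hpar : ∀ s ∈ qubitList (fun q => p q = q), ∀ t ∈ qubitList (fun q => p q = q),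
      Indep s fun z => par (Finset.univ.filter fun q => p q = t ∧ q ≠ t) z := by
    intro s hs t ht z
    refine par_congr fun q hq => flip_of_ne ?_ z
    rintro rfl
    rw [mem_qubitList] at hs
    rw [Finset.mem_filter_univ] at hq
    exact hq.2 (hs.symm.trans hq.1)
  rw [opAll_append, hfan, ← had_diag_had_all hT fun s hs t ht z => ?_, hD]
  · rw [opAll_append, had_all_had_all hT, had_all_had_all hT, ← hφ, hφ, had_diag_had_all hR]
    · funext z
      rw [mix_all_eq_flips hR]
      · congr 1
        funext c
        simp [flips, parBits]
      · exact fun s hs t ht z => hpar s hs t ht z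
    · exact fun s hs t ht z => congrArg sgn (hpar s hs t ht z)
  · rw [flip_of_ne]
    exact fun h => mem_qubitList.1 hs (by rw [← h, hp])

theorem Impl.of_layer {R : Type} [DecidableEq R] [Fintype R] {V : State R → State R} (L : Layer R)
    (h : L.apply = V) : Impl V 1 (Fintype.card R) := h ▸ L.impl

theorem impl_had {R : Type} [DecidableEq R] [Fintype R] {T : List R} (hT : T.Nodup) :
    Impl (opAll T had) 1 (Fintype.card R) :=
  .of_layer (oneQubitLayer T hT fun _ => hadU) (by simp only [apply_oneQubitLayer, apply_hadU])

theorem impl_fanBits {R : Type} [DecidableEq R] [Fintype R] {p : R → R}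
    (hp : ∀ q, p (p q) = p q) :
    Impl (fun ψ z => ψ (fanBits p z)) 1 (Fintype.card R) :=
  .of_layer (fanLayer p) (funext (apply_fanLayer hp))

theorem impl_parBits {R : Type} [DecidableEq R] [Fintype R] {p : R → R}
    (hp : ∀ q, p (p q) = p q) :
    Impl (fun ψ z => ψ (parBits p z)) 3 (3 * Fintype.card R) := by
  have hn : ((qubitList fun q => p q = q) ++ qubitList fun q => p q ≠ q).Nodup :=
    List.nodup_append.2 ⟨nodup_qubitList _, nodup_qubitList _, by
      rintro a ha b hb rfl
      rw [mem_qubitList] at ha hb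
      exact hb ha⟩
  have := ((impl_had hn).comp (impl_fanBits hp)).comp (impl_had (List.nodup_append_comm.1 hn))
  simp only [had_fan_had hp] at this
  exact this.mono (by omega) (by omega)

end Parity

/-! ## Diagonal operators given by parities -/

section Diag

variable {R K : Type} [DecidableEq R] [Fintype R] [DecidableEq K] [Fintype K]

/-- The power `u ^ b`. -/
def phase (u : ℂ) (b : Bool) : ℂ := if b then u else 1

theorem impl_diag_phase {T : List R} (hT : T.Nodup) {u : R → ℂ} (hu : ∀ q, ‖u q‖ = 1) :
    Impl (diag fun z => (T.map fun t => phase (u t) (z t)).prod) 1 (Fintype.card R) := by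
  refine .of_layer (oneQubitLayer T hT fun q => phaseU (u q) (hu q)) ?_
  simp only [apply_oneQubitLayer, apply_phaseU]
  funext ψ
  rw [opAll_diag]
  rfl

omit [Fintype R] in
theorem fanBits_fanBits {p : R → R} (hp : ∀ q, p (p q) = p q) (z : R → Bool) :
    fanBits p (fanBits p z) = z := by
  funext q
  by_cases h : p q = q <;> simp [fanBits, h, hp]

theorem parBits_parBits (p : R → R) (z : R → Bool) :
    parBits p (parBits p z) = z := by
  funext c
  by_cases h : p c = c
  · have : par (Finset.univ.filter fun q => p q = c ∧ q ≠ c) (parBits p z) =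
        par (Finset.univ.filter fun q => p q = c ∧ q ≠ c) z := par_congr fun q hq => by
      simp only [Finset.mem_filter_univ] at hq
      have : p q ≠ q := fun h' => hq.2 (h'.symm.trans hq.1)
      simp [parBits, this]
    rw [parBits, if_pos h, this, parBits, if_pos h]
    simp
  · simp [parBits, h]

/-- A product of phases conditioned on the parities of the sets `S k`. -/
theorem impl_diag_par (S : K → Finset R) {u : K → ℂ} (hu : ∀ k, ‖u k‖ = 1) :
    Impl (diag fun z => ∏ k, phase (u k) (par (S k) z)) 9
      (9 * (Fintype.card R + ∑ k, (S k).card + Fintype.card K)) := by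
  -- The ancillas are a private copy of `q` for every `k` with `q ∈ S k`, and an accumulator for
  -- every `k`. The map `p₁` fans each qubit out to its copies; `p₂` gathers the copies into the
  -- accumulators. Private copies let all parities be taken in the same layers.
  let p₁ : R ⊕ ((Σ k, {q // q ∈ S k}) ⊕ K) → R ⊕ ((Σ k, {q // q ∈ S k}) ⊕ K) := fun
    | .inl q => .inl q
    | .inr (.inl x) => .inl x.2
    | .inr (.inr k) => .inr (.inr k)
  let p₂ : R ⊕ ((Σ k, {q // q ∈ S k}) ⊕ K) → R ⊕ ((Σ k, {q // q ∈ S k}) ⊕ K) := fun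
    | .inl q => .inl q
    | .inr (.inl x) => .inr (.inr x.1)
    | .inr (.inr k) => .inr (.inr k)
  have hp₁ : ∀ q, p₁ (p₁ q) = p₁ q := by rintro (q | x | k) <;> rfl
  have hp₂ : ∀ q, p₂ (p₂ q) = p₂ q := by rintro (q | x | k) <;> rfl
  let u' : R ⊕ ((Σ k, {q // q ∈ S k}) ⊕ K) → ℂ := fun
    | .inr (.inr k) => u k
    | _ => 1
  have hu' : ∀ q, ‖u' q‖ = 1 := by rintro (q | x | k) <;> simp [u', hu]
  -- Copy, gather, apply phases, then undo: 1 + 3 + 1 + 3 + 1 = 9 layers.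
  have key := ((((impl_fanBits hp₁).comp (impl_parBits hp₂)).comp
    (impl_diag_phase (Finset.nodup_toList Finset.univ) hu')).comp (impl_parBits hp₂)).comp
    (impl_fanBits hp₁)
  have hcard : Fintype.card (R ⊕ ((Σ k, {q // q ∈ S k}) ⊕ K)) =
      Fintype.card R + ∑ k, (S k).card + Fintype.card K := by
    simp [Fintype.card_sigma, add_assoc]
  refine .absorb (Y := (Σ k, {q // q ∈ S k}) ⊕ K) (key.mono le_rfl (by rw [← hcard]; omega))
    fun ψ => ?_
  funext z
  simp only [diag, fanBits_fanBits hp₁, parBits_parBits p₂, padZero]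
  split_ifs with hz
  · congr 1
    rw [Finset.prod_map_toList, Fintype.prod_sum_type, Fintype.prod_sum_type]
    have h1 : ∀ b, phase 1 b = 1 := by intro b; cases b <;> rfl
    simp only [u', h1, Finset.prod_const_one, one_mul]
    refine Finset.prod_congr rfl fun k _ => ?_
    congr 1
    apply sgn_injective
    have hk : p₂ (.inr (.inr k)) = .inr (.inr k) := rfl
    rw [parBits, if_pos hk]
    have hz0 : fanBits p₁ z (.inr (.inr k)) = false := by
      have hk : p₁ (.inr (.inr k)) = .inr (.inr k) := rfl
      rw [fanBits, if_pos hk, hz]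
    rw [hz0, Bool.false_xor, sgn_par, sgn_par]
    symm
    rw [← Finset.prod_coe_sort]
    refine Finset.prod_bij (fun q _ => .inr (.inl ⟨k, q⟩)) ?_ ?_ ?_ ?_
    · intro q _
      simp [p₂]
    · intro a _ b _ h
      simpa using h
    · rintro (q | ⟨k', q⟩ | k') h
      · simp [p₂] at h
      · obtain rfl : k' = k := by simpa [p₂] using h
        exact ⟨q, Finset.mem_univ _, rfl⟩
      · simp [p₂] at h
    · intro q _
      have hq : p₁ (.inr (.inl ⟨k, q⟩)) ≠ .inr (.inl ⟨k, q⟩) := by simp [p₁]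
      rw [fanBits, if_neg hq, hz]
      simp [p₁]
  · simp

/-- Phases `v k ^ (z (t k) * par (S k) z)`, applied in the Hadamard basis of the qubits `t k`. -/
theorem impl_mix_all (T : Finset R) (t : K → R) (ht : ∀ k, t k ∈ T) (S : K → Finset R)
    (hS : ∀ k, Disjoint (S k) T) {v : K → ℂ} (hv : ∀ k, ‖v k‖ = 1) :
    Impl (opAll T.toList fun q => mix q fun z => ∏ k with t k = q, phase (v k) (par (S k) z)) 29
      (29 * Fintype.card R + 27 * ∑ k, ((S k).card + 2)) := by
  -- For bits, `2ab = a + b - (a ⊕ b)`. With `v = u ^ 2` this gives `v ^ (ab) = u ^ a * u ^ b * u⁻¹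
  -- ^ (a ⊕ b)`, so a controlled phase is a product of three phases on parities.
  have hroot : ∀ k, ∃ u : ℂ, ‖u‖ = 1 ∧ u * u = v k := fun k => by
    obtain ⟨u, hu⟩ := IsAlgClosed.exists_eq_mul_self (v k)
    refine ⟨u, ?_, hu.symm⟩
    have h := hv k
    rw [hu, norm_mul] at h
    nlinarith [norm_nonneg u]
  choose u hu huv using hroot
  have h := (((impl_diag_par S hu).comp (impl_diag_par (fun k => {t k}) hu)).comp
    (impl_diag_par (fun k => insert (t k) (S k)) (u := fun k => (u k)⁻¹) (by simp [hu])))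
  have htS : ∀ k, t k ∉ S k := fun k hk => Finset.disjoint_left.1 (hS k) hk (ht k)
  have h2 : (fun z => ∏ k, phase (v k) (z (t k) && par (S k) z)) =
      fun z => (T.toList.map fun q =>
        ctrl q (fun z => ∏ k with t k = q, phase (v k) (par (S k) z)) z).prod := by
    funext z
    rw [Finset.prod_map_toList, ← Finset.prod_fiberwise_of_maps_to (t := T) (g := t) (by simp [ht])]
    refine Finset.prod_congr rfl fun q _ => ?_
    have hq : ∀ k ∈ Finset.univ.filter fun k => t k = q,
        phase (v k) (z (t k) && par (S k) z) = phase (v k) (z q && par (S k) z) := fun k hk => by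
      rw [(Finset.mem_filter_univ _).1 hk]
    rw [ctrl, Finset.prod_congr rfl hq]
    cases z q <;> simp [phase]
  have h1 : Impl (diag fun z => (T.toList.map fun q =>
        ctrl q (fun z => ∏ k with t k = q, phase (v k) (par (S k) z)) z).prod) 27
      (27 * Fintype.card R + 27 * ∑ k, ((S k).card + 2)) := by
    simp only [diag_diag, ← Finset.prod_mul_distrib] at h
    rw [← h2]
    convert h.mono (le_refl 27) ?_ using 3
    · rename_i z
      refine Finset.prod_congr rfl fun k _ => ?_
      have := hu k
      have hne : u k ≠ 0 := fun h0 => by simp [h0] at this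
      rw [par_insert (htS k), par_singleton, ← huv]
      cases z (t k) <;> cases par (S k) z <;> simp [phase, hne]
    · simp only [Finset.card_insert_of_notMem (htS _), Finset.card_singleton,
        Finset.sum_add_distrib, Finset.sum_const, smul_eq_mul, Finset.card_univ]
      omega
  have hind : ∀ s ∈ T.toList, ∀ q ∈ T.toList,
      Indep s fun z => ∏ k with t k = q, phase (v k) (par (S k) z) := by
    intro s hs q hq z
    refine Finset.prod_congr rfl fun k _ => ?_
    rw [par_congr fun x hx => flip_of_ne (fun h => ?_) z]
    exact Finset.disjoint_left.1 (hS k) hx (h ▸ Finset.mem_toList.1 hs)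
  have h3 := ((impl_had T.nodup_toList).comp h1).comp (impl_had T.nodup_toList)
  simp only [had_diag_had_all T.nodup_toList hind] at h3
  exact h3.mono (by omega) (by omega)

end Diag

end FanOutCircuit

/-! ## Block-wise disjunctions -/

namespace FanOutCircuit

open Complex

theorem phase_exp (w : ℂ) (b : Bool) : phase (exp w) b = exp (w * ((1 - sgn b) / 2)) := by
  cases b <;> simp [phase]

/-- The disjunction of `m` bits as a linear combination of all parities, in the exponent. -/
theorem prod_phase_par {m : ℕ} (y : Fin m → Bool) :
    ∏ s : Finset (Fin m), phase (exp (2 * Real.pi * I / 2 ^ m)) (par s y) =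
      sgn (decide (∃ i, y i = true)) := by
  -- This product is `2 ^ m` when `y` vanishes and 0 otherwise. The total exponent is accordingly 0
  -- or `π * I`.
  have h : ∑ s : Finset (Fin m), sgn (par s y) = ∏ i, (1 + sgn (y i)) := by
    rw [Finset.prod_one_add, Finset.powerset_univ]
    exact Finset.sum_congr rfl fun s _ => sgn_par s y
  simp only [phase_exp]
  rw [← exp_sum, ← Finset.mul_sum, ← Finset.sum_div, Finset.sum_sub_distrib, h]
  by_cases hy : ∃ i, y i = true
  · obtain ⟨i, hi⟩ := id hy
    rw [Finset.prod_eq_zero (Finset.mem_univ i) (by simp [hi]), decide_eq_true hy, sgn_true,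
      ← exp_pi_mul_I]
    congr 1
    simp
    field_simp
  · have : ∀ i, y i = false := by simpa using hy
    rw [decide_eq_false hy]
    simp [this, one_add_one_eq_two]

/-- The odd part of `w` is detected by the rotation with the matching power of two. -/
theorem exists_exp_pow_eq_neg_one {m w : ℕ} (h0 : w ≠ 0) (hw : w < 2 ^ m) :
    ∃ i : Fin m, exp (2 * Real.pi * I / 2 ^ (i.1 + 1)) ^ w = -1 := by
  obtain ⟨a, b, hb, rfl⟩ := Nat.exists_eq_two_pow_mul_odd h0
  have ha : a < m := by
    by_contra h
    have h1 : 2 ^ m ≤ 2 ^ a := Nat.pow_le_pow_right (by norm_num) (not_lt.1 h)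
    have h2 : 2 ^ a * 1 ≤ 2 ^ a * b := Nat.mul_le_mul_left _ hb.pos
    omega
  refine ⟨⟨a, ha⟩, ?_⟩
  have : exp (2 * Real.pi * I / 2 ^ (a + 1)) ^ 2 ^ a = -1 := by
    rw [← exp_nat_mul, ← exp_pi_mul_I]
    congr 1
    push_cast
    field_simp
    ring
  rw [pow_mul, this, hb.neg_one_pow]

section BlockOr

variable {X Y : Type} [DecidableEq X] [DecidableEq Y] [Fintype X]

/-- Add to each bit `j` the disjunction of the bits in the block `β ⁻¹ {j}`. -/
def orBits (β : X → Y) (z : X ⊕ Y → Bool) : X ⊕ Y → Bool :=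
  Sum.elim (fun x => z (.inl x)) fun j =>
    xor (z (.inr j)) (decide (∃ x, β x = j ∧ z (.inl x) = true))

variable [Fintype Y]

theorem commute_precomp_mix {Q : Type*} [DecidableEq Q] {t : Q} {e : (Q → Bool) → ℂ}
    {π : (Q → Bool) → Q → Bool} (he : ∀ z, e (π z) = e z)
    (hπ : ∀ z, π (flip t z) = flip t (π z)) :
    Function.Commute (fun (ψ : State Q) z => ψ (π z)) (mix t e) := by
  intro ψ
  funext z
  simp only [mix, loc, he, hπ]

/-- The size of a circuit for disjunctions of `x` bits in `y` blocks with fewer than `2 ^ m` bits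
each. -/
def blockCost (x y m : ℕ) : ℕ :=
  87 * (x + y + y * m) + 162 * (x * m) + 27 * (y * 2 ^ m * (m + 2))

/-- Three `impl_mix_all` stages of depth 29: rotate `m` ancillas per block by the block weight, add
their disjunction to the output bit, rotate back. -/
theorem impl_orBits (β : X → Y) (m : ℕ)
    (hm : ∀ j, (Finset.univ.filter fun x => β x = j).card < 2 ^ m) :
    Impl (fun ψ z => ψ (orBits β z)) 87 (blockCost (Fintype.card X) (Fintype.card Y) m) := by
  let T₁ : Finset ((X ⊕ Y) ⊕ Y × Fin m) := Finset.univ.map Function.Embedding.inr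
  let T₂ : Finset ((X ⊕ Y) ⊕ Y × Fin m) :=
    Finset.univ.map (Function.Embedding.inr.trans Function.Embedding.inl)
  let t₁ : X × Fin m → (X ⊕ Y) ⊕ Y × Fin m := fun k => .inr (β k.1, k.2)
  let t₂ : Y × Finset (Fin m) → (X ⊕ Y) ⊕ Y × Fin m := fun k => .inl (.inr k.1)
  let S₁ : X × Fin m → Finset ((X ⊕ Y) ⊕ Y × Fin m) := fun k => {.inl (.inl k.1)}
  let S₂ : Y × Finset (Fin m) → Finset ((X ⊕ Y) ⊕ Y × Fin m) := fun k =>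
    k.2.map ⟨fun i => .inr (k.1, i), fun i i' h => by simpa using h⟩
  let v₁ : X × Fin m → ℂ := fun k => exp (2 * Real.pi * I / 2 ^ (k.2.1 + 1))
  let v₂ : Y × Finset (Fin m) → ℂ := fun _ => exp (2 * Real.pi * I / 2 ^ m)
  have hnorm : ∀ j : ℕ, ‖exp (2 * Real.pi * I / 2 ^ j)‖ = 1 := fun j => by
    have : 2 * Real.pi * I / 2 ^ j = ((2 * Real.pi / 2 ^ j : ℝ) : ℂ) * I := by
      push_cast
      ring
    rw [this, norm_exp_ofReal_mul_I]
  have hv₁ : ∀ k, ‖v₁ k‖ = 1 := fun k => hnorm _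
  have ht₁ : ∀ k, t₁ k ∈ T₁ := fun k => by simp [t₁, T₁]
  have hS₁ : ∀ k, Disjoint (S₁ k) T₁ := fun k => by simp [S₁, T₁]
  have hW := impl_mix_all T₁ t₁ ht₁ S₁ hS₁ hv₁
  have hW' := impl_mix_all T₁ t₁ ht₁ S₁ hS₁ (v := fun k => (v₁ k)⁻¹) (by simp [hv₁])
  have hF := impl_mix_all T₂ t₂ (fun k => by simp [t₂, T₂]) S₂
    (fun k => by
      rw [Finset.disjoint_left]
      intro q hq
      obtain ⟨i, -, rfl⟩ := Finset.mem_map.1 hq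
      simp [T₂]) (v := v₂) (fun k => hnorm _)
  have key := (hW.comp hF).comp hW'
  let e₁ : (X ⊕ Y) ⊕ Y × Fin m → ((X ⊕ Y) ⊕ Y × Fin m → Bool) → ℂ := fun q z =>
    ∏ k with t₁ k = q, phase (v₁ k) (par (S₁ k) z)
  let f : (X ⊕ Y) ⊕ Y × Fin m → ((X ⊕ Y) ⊕ Y × Fin m → Bool) → Bool := fun q z =>
    match q with
    | .inl (.inr j) => decide (∃ i, z (.inr (j, i)) = true)
    | _ => false
  have he₁ : ∀ j i z, e₁ (.inr (j, i)) z =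
      exp (2 * Real.pi * I / 2 ^ (i.1 + 1)) ^
        (Finset.univ.filter fun x => β x = j ∧ z (.inl (.inl x)) = true).card := by
    intro j i z
    simp only [e₁, Finset.prod_filter, Fintype.prod_prod_type, t₁, S₁, v₁, par_singleton,
      Sum.inr.injEq, Prod.mk.injEq]
    rw [← Finset.prod_const, Finset.prod_filter]
    refine Finset.prod_congr rfl fun x _ => ?_
    rw [Finset.prod_eq_single i (fun i' _ hi' => by simp [hi']) (by simp)]
    by_cases hx : β x = j <;> simp [hx, phase]
  have hf : ∀ q ∈ T₂.toList, (fun z => ∏ k with t₂ k = q, phase (v₂ k) (par (S₂ k) z)) =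
      fun z => sgn (f q z) := by
    intro q hq
    funext z
    obtain ⟨j, -, rfl⟩ := Finset.mem_map.1 (Finset.mem_toList.1 hq)
    simp only [Function.Embedding.trans_apply, Function.Embedding.inr_apply,
      Function.Embedding.inl_apply, f]
    rw [← prod_phase_par fun i => z (.inr (j, i)), Finset.prod_filter, Fintype.prod_prod_type,
      Finset.prod_eq_single j (fun j' _ hj' => by simp [t₂, hj']) (by simp)]
    refine Finset.prod_congr rfl fun s _ => ?_
    have hs : par (S₂ (j, s)) z = par s fun i => z (.inr (j, i)) := Finset.fold_map
    rw [if_pos rfl, hs]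
  have hind : ∀ s ∈ T₁.toList, ∀ q ∈ T₁.toList, Indep s (e₁ q) := by
    intro s hs q hq z
    obtain ⟨⟨j, i⟩, -, rfl⟩ := Finset.mem_map.1 (Finset.mem_toList.1 hq)
    obtain ⟨⟨j', i'⟩, -, rfl⟩ := Finset.mem_map.1 (Finset.mem_toList.1 hs)
    have h : ∀ x, flip (Function.Embedding.inr (j', i')) z (.inl (.inl x)) = z (.inl (.inl x)) :=
      fun x => flip_of_ne (by simp) z
    simp only [Function.Embedding.inr_apply, he₁] at h ⊢
    simp only [h]
  have hne : ∀ q z, e₁ q z ≠ 0 := fun q z => Finset.prod_ne_zero_iff.2 fun k _ => by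
    have : v₁ k ≠ 0 := exp_ne_zero _
    cases par (S₁ k) z <;> simp [phase, this]
  have hinv : ∀ q, (fun z => ∏ k with t₁ k = q, phase (v₁ k)⁻¹ (par (S₁ k) z)) =
      fun z => (e₁ q z)⁻¹ := by
    intro q
    funext z
    simp only [e₁]
    rw [← Finset.prod_inv_distrib]
    refine Finset.prod_congr rfl fun k _ => ?_
    cases par (S₁ k) z <;> simp [phase]
  -- The ideal map `π` reads the inputs directly, while the circuit reads the ancillas. They agree
  -- on strings satisfying `P`, which support the rotated state.
  let π : ((X ⊕ Y) ⊕ Y × Fin m → Bool) → (X ⊕ Y) ⊕ Y × Fin m → Bool := fun z =>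
    Sum.elim (orBits β (z ∘ Sum.inl)) (z ∘ Sum.inr)
  let P : ((X ⊕ Y) ⊕ Y × Fin m → Bool) → Prop := fun z => ∀ j,
    (∃ i, z (.inr (j, i)) = true) ↔ ∃ x, β x = j ∧ z (.inl (.inl x)) = true
  have hsupp : ∀ (ψ : State (X ⊕ Y)) z,
      opAll T₁.toList (fun q => mix q (e₁ q)) (padZero ψ) z ≠ 0 → P z := by
    intro ψ z hz j
    have h := support_mix_all T₁.nodup_toList hind (fun z hz t ht => ?_) z hz
    · constructor
      · rintro ⟨i, hi⟩
        have h1 := (h (.inr (j, i)) (by simp [T₁])).1 hi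
        by_contra hx
        refine h1 ?_
        rw [he₁, Finset.card_eq_zero.2, pow_zero]
        simpa [Finset.filter_eq_empty_iff] using hx
      · rintro ⟨x, hx⟩
        obtain ⟨i, hi⟩ := exists_exp_pow_eq_neg_one (m := m)
          (w := (Finset.univ.filter fun x => β x = j ∧ z (.inl (.inl x)) = true).card)
          (Finset.card_ne_zero_of_mem (Finset.mem_filter.2 ⟨Finset.mem_univ x, hx⟩))
          ((Finset.card_le_card fun x => by simp; tauto).trans_lt (hm j))
        refine ⟨i, ?_⟩
        by_contra hzi
        exact (h (.inr (j, i)) (by simp [T₁])).2 (by simpa using hzi) (by rw [he₁, hi])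
    · obtain ⟨a, -, rfl⟩ := Finset.mem_map.1 (Finset.mem_toList.1 ht)
      by_contra hza
      exact hz (if_neg fun h => hza (h a))
  have hflip : ∀ z, P z → flips T₂.toList f z = π z := by
    intro z hz
    funext q
    rcases q with (x | j) | a
    · simp [flips, T₂, π, orBits]
    · simp [flips, T₂, π, orBits, f, hz j]
    · simp [flips, T₂, π]
  have hP₁ : ∀ z, P (flips T₂.toList f z) → P z := fun z h j => by
    simpa [flips, T₂] using h j
  have hP₂ : ∀ z, P (π z) → P z := fun z h j => by
    simpa [π, orBits] using h j
  have main : ∀ ψ : State (X ⊕ Y),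
      opAll T₁.toList (fun q => mix q fun z => (e₁ q z)⁻¹)
        (opAll T₂.toList (fun q => mix q fun z => sgn (f q z))
          (opAll T₁.toList (fun q => mix q (e₁ q)) (padZero ψ))) =
        padZero fun z => ψ (orBits β z) := by
    intro ψ
    have h1 : opAll T₂.toList (fun q => mix q fun z => sgn (f q z))
          (opAll T₁.toList (fun q => mix q (e₁ q)) (padZero ψ)) =
        fun z => opAll T₁.toList (fun q => mix q (e₁ q)) (padZero ψ) (π z) := by
      funext z
      rw [mix_all_eq_flips T₂.nodup_toList]
      · by_cases hz : P z
        · rw [hflip z hz]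
        -- Neither map leads from outside `P` into `P`, so both amplitudes vanish here.
        · rw [not_not.1 fun h => hz (hP₁ z (hsupp ψ _ h)),
            not_not.1 fun h => hz (hP₂ z (hsupp ψ _ h))]
      · intro s hs t ht z
        obtain ⟨j, -, rfl⟩ := Finset.mem_map.1 (Finset.mem_toList.1 hs)
        obtain ⟨j', -, rfl⟩ := Finset.mem_map.1 (Finset.mem_toList.1 ht)
        simp [f, flip]
    -- The rotation angles depend only on the inputs, which `π` leaves alone. Hence `π` moves past
    -- the rotations, and the last stage cancels the first.
    have h2 : Function.Commute (fun (ψ : State ((X ⊕ Y) ⊕ Y × Fin m)) z => ψ (π z))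
        (opAll T₁.toList fun q => mix q (e₁ q)) := opAll_commute fun t ht => by
      obtain ⟨⟨j, i⟩, -, rfl⟩ := Finset.mem_map.1 (Finset.mem_toList.1 ht)
      refine commute_precomp_mix (fun z => ?_) fun z => ?_
      · simp only [Function.Embedding.inr_apply, he₁]
        rfl
      · funext q
        rcases q with (x | j') | a <;> simp [π, orBits, flip, Function.update_apply]
    have h3 := h2 (padZero ψ)
    beta_reduce at h3
    rw [h1, h3, mix_inv_mix_all T₁.nodup_toList hind hne]
    rfl
  simp only [hinv] at key
  have hf' := opAll_congr (T := T₂.toList)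
    (f := fun q => mix q fun z => ∏ k with t₂ k = q, phase (v₂ k) (par (S₂ k) z))
    (g := fun q => mix q fun z => sgn (f q z)) fun q hq => by rw [hf q hq]
  rw [hf'] at key
  refine .absorb (key.mono (le_refl 87) ?_) main
  have c₁ : ∑ k, ((S₁ k).card + 2) = 3 * (Fintype.card X * m) := by
    simp [S₁, mul_comm]
  have c₂ : ∑ k, ((S₂ k).card + 2) ≤ Fintype.card Y * 2 ^ m * (m + 2) := by
    have : ∀ k ∈ Finset.univ, (S₂ k).card + 2 ≤ m + 2 := fun k _ => by
      simpa [S₂] using Finset.card_le_univ k.2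
    simpa using Finset.sum_le_card_nsmul _ _ _ this
  have c₃ : Fintype.card ((X ⊕ Y) ⊕ Y × Fin m) =
      Fintype.card X + Fintype.card Y + Fintype.card Y * m := by simp
  rw [blockCost, c₁, c₃]
  omega

end BlockOr

end FanOutCircuit

/-! ## Composition of block-wise disjunctions -/

namespace FanOutCircuit

open Function

section Compose

variable {X Y Z : Type} [DecidableEq X] [DecidableEq Y] [DecidableEq Z] [Fintype X] [Fintype Y]

/-- Block values are computed into ancillas, used, and uncomputed. Only the `β` stage runs twice, so
iterating with `γ` as the recursive part keeps the depth linear in the number of levels. -/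
theorem Impl.orBits_comp {β : X → Y} {γ : Y → Z} {D S D' S' : ℕ}
    (hβ : Impl (fun ψ z => ψ (orBits β z)) D S) (hγ : Impl (fun ψ z => ψ (orBits γ z)) D' S') :
    Impl (fun ψ z => ψ (orBits (γ ∘ β) z)) (D + D' + D) (S + S' + S) := by
  let e₁ : X ⊕ Y ↪ (X ⊕ Z) ⊕ Y := ⟨Sum.elim (fun x => .inl (.inl x)) .inr, by
    rintro (a | a) (b | b) <;> simp⟩
  let e₂ : Y ⊕ Z ↪ (X ⊕ Z) ⊕ Y := ⟨Sum.elim .inr (fun c => .inl (.inr c)), by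
    rintro (a | a) (b | b) <;> simp⟩
  have h := ((hβ.lift e₁).comp (hγ.lift e₂)).comp (hβ.lift e₁)
  refine h.absorb fun ψ => ?_
  have c1 : ∀ x, e₁ (.inl x) = .inl (.inl x) := fun _ => rfl
  have c2 : ∀ j, e₁ (.inr j) = .inr j := fun _ => rfl
  have c3 : ∀ j, e₂ (.inl j) = .inr j := fun _ => rfl
  have c4 : ∀ c, e₂ (.inr c) = .inl (.inr c) := fun _ => rfl
  have a1 : ∀ (y : X ⊕ Y → Bool) z x, extend e₁ y z (.inl (.inl x)) = y (.inl x) := fun y z x =>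
    e₁.injective.extend_apply y z (.inl x)
  have a2 : ∀ (y : X ⊕ Y → Bool) z j, extend e₁ y z (.inr j) = y (.inr j) := fun y z j =>
    e₁.injective.extend_apply y z (.inr j)
  have a3 : ∀ (y : X ⊕ Y → Bool) z c, extend e₁ y z (.inl (.inr c)) = z (.inl (.inr c)) :=
    fun y z c => extend_apply' _ _ _ (by
      rintro ⟨a | a, h⟩
      · simp [c1] at h
      · simp [c2] at h)
  have b1 : ∀ (y : Y ⊕ Z → Bool) z c, extend e₂ y z (.inl (.inr c)) = y (.inr c) := fun y z c =>
    e₂.injective.extend_apply y z (.inr c)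
  have b2 : ∀ (y : Y ⊕ Z → Bool) z j, extend e₂ y z (.inr j) = y (.inl j) := fun y z j =>
    e₂.injective.extend_apply y z (.inl j)
  have b3 : ∀ (y : Y ⊕ Z → Bool) z x, extend e₂ y z (.inl (.inl x)) = z (.inl (.inl x)) :=
    fun y z x => extend_apply' _ _ _ (by
      rintro ⟨a | a, h⟩
      · simp [c3] at h
      · simp [c4] at h)
  funext z
  simp only [FanOutCircuit.lift, slice, padZero, orBits, a2, b2, c1, c2, c3, b3, a1, comp_apply,
    Sum.elim_inl, Sum.elim_inr, Bool.xor_assoc, Bool.xor_self, Bool.xor_false]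
  split_ifs with hz
  · congr 1
    funext q
    rcases q with x | c
    · simp only [comp_apply, a1, Sum.elim_inl]
    · simp only [comp_apply, a3, b1, c4, hz, Sum.elim_inr]
      congr 2
      simp
  · rfl

end Compose

/-! ## The recursion -/

/-! ### Bounds for the truncated iterated logarithm -/

theorem ilog_pos (d : ℕ) {x : ℝ} (hx : 1 ≤ x) : 1 ≤ ilog d x := by
  cases d with
  | zero => exact hx
  | succ d => exact le_max_left _ _

theorem ilog_mono (d : ℕ) {x y : ℝ} (hx : 1 ≤ x) (hxy : x ≤ y) : ilog d x ≤ ilog d y := by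
  induction d with
  | zero => exact hxy
  | succ d ih =>
    exact max_le_max_left _ (Real.logb_le_logb_of_le (by norm_num)
      (zero_lt_one.trans_le (ilog_pos d hx)) ih)

theorem ilog_le_self (d : ℕ) {x : ℝ} (hx : 1 ≤ x) : ilog d x ≤ x := by
  induction d with
  | zero => exact le_rfl
  | succ d ih =>
    have h0 := ilog_pos d hx
    refine max_le hx (le_trans ?_ ih)
    rw [Real.logb_le_iff_le_rpow (by norm_num) (by linarith)]
    have := one_add_mul_self_le_rpow_one_add (s := 1) (by norm_num) h0
    norm_num at this
    linarith

/-- With `m = Nat.log 2 B + 1` one has `N * 2 ^ m ≤ 2 * N * B ≤ 4 * n` and `m + 2 ≤ 3 * m`. The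
three terms of the cost contribute at most 261 + 162 + 324 = 747 times `n * m`. -/
theorem blockCost_le {n N B : ℕ} (h₁ : N ≤ n) (h₂ : N * B ≤ 2 * n) (hB : 1 ≤ B) :
    blockCost n N (Nat.log 2 B + 1) ≤ 750 * (n * (Nat.log 2 B + 1)) := by
  set l := Nat.log 2 B
  have h3 : 2 ^ l ≤ B := Nat.pow_log_le_self 2 (by omega)
  have h4 : N * 2 ^ (l + 1) ≤ 4 * n := by
    rw [pow_succ]
    nlinarith [Nat.mul_le_mul_left N h3]
  have h5 := Nat.mul_le_mul_right (l + 1 + 2) h4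
  have h6 := Nat.mul_le_mul_right (l + 1) h₁
  rw [blockCost]
  nlinarith

/-- The induction closes because two block stages cost `2 * 750 * n * m` with `m ≤ 3 * ilog (d + 1)
n`, which is the first summand. The recursive call on `N` bits contributes `4500 * N * ilog d N ≤
9000 * n`, which raises `d` by one in the second. -/
theorem impl_or (d : ℕ) : ∀ n : ℕ, 1 ≤ n → ∃ D S : ℕ,
    Impl (fun (ψ : State (Fin n ⊕ Fin 1)) z => ψ (orBits (fun _ => 0) z)) D S ∧
      D ≤ 87 * (2 * d + 1) ∧ (S : ℝ) ≤ 4500 * n * ilog d n + 9000 * d * n := by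
  induction d with
  | zero =>
    intro n hn
    refine ⟨_, _, impl_orBits (fun _ => 0) (Nat.log 2 n + 1) fun j => ?_, le_rfl, ?_⟩
    · refine (Finset.card_le_univ _).trans_lt ?_
      rw [Fintype.card_fin]
      exact Nat.lt_pow_succ_log_self (by norm_num) n
    · have h := blockCost_le (n := n) (N := 1) (B := n) hn (by omega) hn
      have h' := Nat.mul_le_mul_left n (Nat.succ_le_of_lt (Nat.log_lt_self 2 (x := n) (by omega)))
      have : blockCost n 1 (Nat.log 2 n + 1) ≤ 4500 * n * n := by
        rw [Nat.succ_eq_add_one] at h'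
        nlinarith
      simpa [ilog] using (Nat.cast_le (α := ℝ)).2 this
  | succ d ih =>
    intro n hn
    have hn' : (1 : ℝ) ≤ n := by exact_mod_cast hn
    have hL := ilog_pos d hn'
    set L := ilog d n with hLdef
    set B := ⌈L⌉₊
    have hLB : L ≤ B := Nat.le_ceil L
    have hB : 1 ≤ B := by exact_mod_cast hL.trans hLB
    have hBL : (B : ℝ) ≤ 2 * L := by
      have := Nat.ceil_lt_add_one (a := L) (by linarith)
      linarith
    have hBn : B ≤ n := Nat.ceil_le.2 (ilog_le_self d hn')
    set N := (n - 1) / B + 1 with hN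
    have hN0 : 1 ≤ N := Nat.le_add_left 1 _
    have hNn : N ≤ n := by
      have := Nat.div_le_self (n - 1) B
      omega
    have hNB : N * B ≤ 2 * n := by
      have := Nat.div_mul_le_self (n - 1) B
      rw [hN, add_mul]
      omega
    let β : Fin n → Fin N := fun x => ⟨x / B, by
      have := Nat.div_le_div_right (c := B) (show x.1 ≤ n - 1 by omega)
      exact Nat.lt_succ_of_le this⟩
    set m := Nat.log 2 B + 1 with hm
    have hβ := impl_orBits β m fun j => by
      refine lt_of_le_of_lt ?_ (Nat.lt_pow_succ_log_self (by norm_num) B)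
      rw [← Finset.card_range B]
      refine Finset.card_le_card_of_injOn (fun x => x.1 % B)
        (fun x _ => Finset.mem_coe.2 (Finset.mem_range.2 (Nat.mod_lt _ hB))) fun x hx y hy h => ?_
      simp only [Finset.coe_filter, Finset.mem_univ, true_and, Set.mem_ofPred_eq, β] at hx hy h
      have h' : x.1 / B = y.1 / B := by
        have := hx.trans hy.symm
        simpa using this
      exact Fin.ext (by rw [← Nat.div_add_mod x.1 B, ← Nat.div_add_mod y.1 B, h, h'])
    obtain ⟨D, S, hI, hD, hS⟩ := ih N hN0
    refine ⟨_, _, hβ.orBits_comp hI, by omega, ?_⟩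
    have hc : (blockCost n N m : ℝ) ≤ 750 * (n * m) := by
      exact_mod_cast blockCost_le hNn hNB hB
    have hm' : (m : ℝ) ≤ 3 * ilog (d + 1) n := by
      have h1 : (Nat.log 2 B : ℝ) ≤ Real.logb 2 B := by
        have := Real.natLog_le_logb B 2
        exact_mod_cast this
      have h2 : Real.logb 2 B ≤ 1 + Real.logb 2 L := by
        have h := Real.logb_le_logb_of_le (b := 2) (by norm_num) (by positivity) hBL
        rwa [Real.logb_mul (by norm_num) (by linarith), Real.logb_self_eq_one (by norm_num)] at h
      have h3 : Real.logb 2 L ≤ ilog (d + 1) n := le_max_right _ _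
      have h4 : 1 ≤ ilog (d + 1) n := le_max_left _ _
      rw [hm]
      push_cast
      linarith
    have hNn' : (N : ℝ) ≤ n := by exact_mod_cast hNn
    have hN1 : (1 : ℝ) ≤ N := by exact_mod_cast hN0
    -- The block length was chosen for this: `ilog d N ≤ ilog d n ≤ B`.
    have hlow : (N : ℝ) * ilog d N ≤ 2 * n := by
      have h1 : (N : ℝ) * B ≤ 2 * n := by exact_mod_cast hNB
      have h2 : ilog d N ≤ B := (ilog_mono d hN1 hNn').trans hLB
      nlinarith
    have h5 : (n : ℝ) * m ≤ n * (3 * ilog (d + 1) n) := by gcongr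
    have h6 : (d : ℝ) * N ≤ d * n := by gcongr
    simp only [Fintype.card_fin]
    push_cast
    linarith

/-- Inputs and output in product form, with the ancillas in `|0⟩`. -/
theorem slice_tensor₃ {n : ℕ} {A : Type} [Fintype A] (φ₁ : State (Fin n)) (φ₂ : State (Fin 1))
    (e : (Fin n ⊕ Fin 1) ⊕ A ↪ Fin n ⊕ Fin 1 ⊕ Fin (Fintype.card A))
    (he : e = ((Equiv.sumAssoc _ _ _).trans ((Equiv.refl _).sumCongr
      ((Equiv.refl _).sumCongr (Fintype.equivFin A)))).toEmbedding) (z) :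
    slice e z (tensor₃ φ₁ φ₂ (ket (zeros _))) =
      padZero fun y => φ₁ (y ∘ Sum.inl) * φ₂ (y ∘ Sum.inr) := by
  funext y
  have h1 : ∀ i, extend e y z (.inl i) = y (.inl (.inl i)) := fun i => by
    rw [← e.injective.extend_apply y z, he]; rfl
  have h2 : ∀ i, extend e y z (.inr (.inl i)) = y (.inl (.inr i)) := fun i => by
    rw [← e.injective.extend_apply y z, he]; rfl
  have h3 : ∀ a, extend e y z (.inr (.inr (Fintype.equivFin A a))) = y (.inr a) := fun i => by
    rw [← e.injective.extend_apply y z, he]; rfl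
  have h4 : (fun k => extend e y z (.inr (.inr k))) = zeros _ ↔ ∀ a, y (.inr a) = false := by
    refine ⟨fun h a => by rw [← h3]; exact congrFun h _, fun h => funext fun k => ?_⟩
    obtain ⟨a, rfl⟩ := (Fintype.equivFin A).surjective k
    rw [h3]
    exact h a
  simp only [slice, tensor₃, padZero, ket, h1, h2, h4, mul_ite, mul_one, mul_zero]
  rfl

end FanOutCircuit

/-! ### The Or-reduction on the prescribed registers -/

open FanOutCircuit in
theorem mainTheorem9 :
    ∃ c₁ c₂ : ℝ, ∀ d : ℕ, 1 ≤ d → ∀ n : ℕ, 1 ≤ n →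
      ∃ (a : ℕ) (C : FanOutCircuit.Circuit (Fin n ⊕ Fin 1 ⊕ Fin a)),
        FanOutCircuit.IsOrReduction (1 / (n : ℝ)) C ∧
        (FanOutCircuit.Circuit.depth C : ℝ) ≤ c₁ * d ∧
        (FanOutCircuit.Circuit.size C : ℝ) ≤ c₂ * d * n * FanOutCircuit.ilog d n := by
  -- For `d ≥ 1`, `87 * (2 * d + 1) ≤ 261 * d`, and 13500 = 4500 + 9000.
  refine ⟨261, 13500, fun d hd n hn => ?_⟩
  obtain ⟨D, S, ⟨A, _, _, C, hC, hD', hS'⟩, hD, hS⟩ := impl_or d n hn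
  let e := ((Equiv.sumAssoc (Fin n) (Fin 1) A).trans ((Equiv.refl _).sumCongr
      ((Equiv.refl _).sumCongr (Fintype.equivFin A)))).toEmbedding
  refine ⟨Fintype.card A, Circuit.map e C, fun x => ?_, ?_, ?_⟩
  · have hw : hammingWeight x = 0 ↔ ¬ ∃ i, x i = true := by
      simp [hammingWeight, Finset.filter_eq_empty_iff]
    -- The output is a basis state, so its overlap with `|0⟩` is exactly 0 for nonzero inputs.
    refine ⟨ket fun _ => decide (∃ i, x i = true), ?_, fun h => ?_, fun h => ?_⟩
    · funext z
      rw [← slice_apply_comp e z (Circuit.apply _ _), Circuit.slice_apply_map,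
        slice_tensor₃ _ _ e rfl, hC, ← slice_apply_comp e z (tensor₃ _ _ _),
        slice_tensor₃ _ _ e rfl]
      congr 2
      funext y
      have hy₁ : orBits (fun _ => (0 : Fin 1)) y ∘ Sum.inl = y ∘ Sum.inl := rfl
      beta_reduce
      rw [hy₁]
      by_cases hy : y ∘ Sum.inl = x
      · have hyx : ∀ i, y (.inl i) = x i := congrFun hy
        have hiff : orBits (fun _ => (0 : Fin 1)) y ∘ Sum.inr = zeros (Fin 1) ↔
            y ∘ Sum.inr = fun _ => decide (∃ i, x i = true) := by
          simp [funext_iff, orBits, zeros, hyx]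
        simp only [ket, hiff]
        congr!
      · simp [ket, hy]
    · rw [decide_eq_false (hw.1 h)]
      rfl
    · have hx := not_not.1 fun h' => h (hw.2 h')
      have : zeros (Fin 1) ≠ fun _ => decide (∃ i, x i = true) := fun h' => by
        have := congrFun h' 0
        simp [zeros, hx] at this
      simp only [ket, this, if_false, norm_zero]
      positivity
  · rw [Circuit.depth_map]
    have h1 : Circuit.depth C ≤ 261 * d := by omega
    exact_mod_cast h1
  · rw [Circuit.size_map]
    have h1 : (Circuit.size C : ℝ) ≤ S := by exact_mod_cast hS'
    have h2 : 1 ≤ ilog d n := ilog_pos d (by exact_mod_cast hn)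
    have h3 : (1 : ℝ) ≤ d := by exact_mod_cast hd
    have h4 : (n : ℝ) * ilog d n ≤ d * (n * ilog d n) := le_mul_of_one_le_left (by positivity) h3
    have h5 : (d : ℝ) * n ≤ d * n * ilog d n := le_mul_of_one_le_right (by positivity) h2
    nlinarith
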